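/- **Theorem 3.3.** Let $N\ge 2$ be an integer and let $\Omega_N$ be the hierarchical group of order $N$, that is, the set of sequences $x=(x_1,x_2,\dots)$ with $x_i\in\{0,1,\dots,N-1\}$ and only finitely many $x_i\ne 0$, with componentwise addition mod $N$, equipped with the distance $d(x,x)=0$ and $d(x,y)=\max\{i: x_i\neq y_i\}$ for $x\ne y$. Given real numbers $\alpha\ge 0$ and $C_0,C_1,C_2\ge 0$, put $$c_k=C_0+C_1\log k+C_2k^{\alpha},\qquad k\ge 1,$$ and let $\mathcal G_N$ be the random graph with vertex set $\Omega_N$ in which each pair of distinct points $x,y$ with $d(x,y)=k$ is joined by an (undirected) edge with probability $\min(c_k/N^{2k},1)$, independently for different pairs. (This is the case $\delta=1$ of the connection probabilities $\min(c_k/N^{k(1+\delta)},1)$.) A cluster is a connected component of $\mathcal G_N$, and percolation is said to occur if with positive probability the point $\mathbf 0$ belongs to an infinite cluster. (a) If $\alpha>2$, then for every $C_1\ge 0$ there exist $C_0^*>0$ and $C_2^*>0$ such that, whenever $C_0>C_0^*$ and $C_2>C_2^*$, percolation occurs and, with probability $1$, there is exactly one infinite cluster. (b) If $C_2=0$ and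 $C_1<N$, then percolation does not occur, for any $C_0\ge 0$. (c) If $\alpha>2$, then there exists $C_*>0$ such that percolation does not occur whenever $\max(C_0,C_1,C_2)<C_*$. The constants $C_0^*,C_2^*$ may depend on $N,\alpha,C_1$, and $C_*$ on $N,\alpha$. -/

import Mathlib

open MeasureTheory

/-- The hierarchical group of order `N`: the direct sum of countably many copies of the cyclic
group of order `N`. Coordinates are indexed from `0` here, so `x i` is the coordinate usually
written `x_{i+1}`. -/
abbrev HierGroup (N : ℕ) : Type := ℕ →₀ ZMod N

/-- The hierarchical distance: `0` if `x = y`, and otherwise the largest `i ≥ 1` such that the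
`i`-th coordinates (counted from `1`) of `x` and `y` differ. -/
def hierDist {N : ℕ} (x y : HierGroup N) : ℕ :=
  (x.neLocus y).sup (fun i => i + 1)

/-- The probability `min (c_k / N^{k(1+δ)}, 1)` of a connection between two given points at
distance `k`. -/
noncomputable def connProb (N : ℕ) (δ : ℝ) (c : ℕ → ℝ) (k : ℕ) : ℝ :=
  min (c k / (N : ℝ) ^ ((k : ℝ) * (1 + δ))) 1

/-- The sample space: one label in `[0, 1]` for each unordered pair of points
(the labels of the degenerate pairs `{x, x}` are never used). -/
abbrev EdgeLabels (N : ℕ) : Type := Sym2 (HierGroup N) → unitInterval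

/-- The law under which the labels are independent and uniform on `[0, 1]`. -/
noncomputable def labelLaw (N : ℕ) : Measure (EdgeLabels N) :=
  Measure.infinitePi (fun _ : Sym2 (HierGroup N) => (volume : Measure unitInterval))

/-- The random graph: distinct points `x, y` are joined by an undirected edge iff the label of
`{x, y}` is at most the connection probability at distance `d(x, y)`. Under `labelLaw N` all
connections are therefore independent, with the prescribed probabilities. -/
def hierGraph (N : ℕ) (δ : ℝ) (c : ℕ → ℝ) (U : EdgeLabels N) : SimpleGraph (HierGroup N) where
  Adj x y := x ≠ y ∧ ((U s(x, y) : unitInterval) : ℝ) ≤ connProb N δ c (hierDist x y)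
  symm := ⟨fun x y h => by
    refine ⟨h.1.symm, ?_⟩
    have hd : hierDist y x = hierDist x y := by
      unfold hierDist
      rw [Finsupp.neLocus_comm]
    rw [Sym2.eq_swap, hd]
    exact h.2⟩
  loopless := ⟨fun _ h => h.1 rfl⟩

/-- Percolation occurs: with positive probability the point `0` belongs to an infinite cluster,
i.e. its connected component is infinite. -/
def Percolates (N : ℕ) (δ : ℝ) (c : ℕ → ℝ) : Prop :=
  0 < labelLaw N
    {U | ((hierGraph N δ c U).connectedComponentMk (0 : HierGroup N)).supp.Infinite}

/-- With probability one there is exactly one infinite cluster (connected component). -/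
def UniqueInfiniteCluster (N : ℕ) (δ : ℝ) (c : ℕ → ℝ) : Prop :=
  ∀ᵐ U ∂(labelLaw N), ∃! K : (hierGraph N δ c U).ConnectedComponent, K.supp.Infinite

/-- The connection rates `c_k = C₀ + C₁ log k + C₂ k^α` (used for `k ≥ 1` only). -/
noncomputable def criticalRate (C₀ C₁ C₂ α : ℝ) (k : ℕ) : ℝ :=
  C₀ + C₁ * Real.log (k : ℝ) + C₂ * (k : ℝ) ^ α

/-! ### Ultrametric geometry of the hierarchical group -/

section Geometry

variable {N : ℕ}

/-! A ball of radius `k` has `N ^ k` points, and the expected number of edges from it to points at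
distance `k + 1 + i` is at most `(1 - 1/N) N^{-(i+1)} c_{k+1+i}`. These weights sum to `1/N`, so for
slowly growing rates about `c_k / N` edges leave the ball. Whether the graph percolates depends on
how this number grows.

(c) The expected degree is at most `∑ c_j / N^j`, which is below `1` for small constants. The
expected number of self-avoiding paths of length `n` from `0` then decays geometrically
(`tsum_prob_avoidingPath_le`), so the cluster of `0` is finite.

(b) With `c_k = C₀ + C₁ log k`, a ball of radius `k` has no edge to a given larger concentric ball
with probability at least `a k^{-β}`, where `β` is slightly above `C₁ / N` and below `1`
(`exists_prob_noCrossing_ge`). These events are independent along an increasing sequence of radii.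
Among `t ^ p` radii spaced by `t`, one is isolated except with probability `exp (-b t)`, and edges
that jump over a whole scale have total probability of order `t^{2p+1} / N^t`. An isolated scale
without jumps encloses the cluster of `0`.

(a) Renormalise along radii `k n` for which a ball of radius `k (n+1)` has about `w n = (n + n₀)^γ`
sub-balls, with `1 < γ < α/2`. A ball is good if at most one sub-ball has lost its core and the
surviving cores are pairwise joined. Losing one sub-ball per scale costs a density factor `1 - 1/w
n`, with convergent product since `γ > 1`, so a nonempty core always has density at least `1/2`
(`card_coreBall_ge`). Two such cores then fail to be joined with probability at most `exp (-(n +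
n₀)^{α - 2γ})` (`prob_core_not_joined_le`). Two sub-balls fail independently, so the failure
probability `b n` obeys `b (n+1) ≲ w n ^ 2 (b n ^ 2 + e n)`, which is summable
(`prob_not_goodAt_le`). The core is connected because balls of the initial radius are complete
graphs when `C₀` is large.

For uniqueness, almost surely all large balls around `0` are good, so core points far out belong to
one cluster. Any other infinite cluster would leave every large ball. Each time, one of its exit
points lies in the core at its own scale with conditional probability at least `1/2`, by labels not
yet examined, so avoiding the core forever has probability zero (`prob_forall_failedExit_eq_zero`).
-/

theorem hierDist_le_iff {x y : HierGroup N} {k : ℕ} :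
    hierDist x y ≤ k ↔ ∀ i, k ≤ i → x i = y i := by
  unfold hierDist
  rw [Finset.sup_le_iff]
  constructor
  · intro h i hi
    by_contra hne
    have := h i (by simpa [Finsupp.mem_neLocus] using hne)
    omega
  · intro h i hi
    by_contra hlt
    exact (Finsupp.mem_neLocus.1 hi) (h i (by omega))

theorem hierDist_comm (x y : HierGroup N) : hierDist x y = hierDist y x := by
  unfold hierDist
  rw [Finsupp.neLocus_comm]

theorem hierDist_self (x : HierGroup N) : hierDist x x = 0 := by
  simp [hierDist]

theorem hierDist_eq_zero {x y : HierGroup N} : hierDist x y = 0 ↔ x = y := by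
  constructor
  · intro h
    ext i
    exact hierDist_le_iff.1 h.le i (Nat.zero_le i)
  · rintro rfl
    exact hierDist_self x

theorem hierDist_trans_le {x y z : HierGroup N} {k : ℕ} (h₁ : hierDist x y ≤ k)
    (h₂ : hierDist y z ≤ k) : hierDist x z ≤ k := by
  rw [hierDist_le_iff] at *
  intro i hi
  rw [h₁ i hi, h₂ i hi]

/-- The isosceles property of an ultrametric. It makes the connection probability constant over all
pairs taken from two separated balls. -/
theorem hierDist_eq_of_lt {x y z : HierGroup N} {k : ℕ} (h : hierDist x y ≤ k)
    (hz : k < hierDist x z) : hierDist y z = hierDist x z := by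
  apply le_antisymm
  · exact hierDist_trans_le (k := hierDist x z) (by rw [hierDist_comm]; omega) le_rfl
  · by_contra! hlt
    have : hierDist x z ≤ max k (hierDist y z) :=
      hierDist_trans_le (h.trans (le_max_left _ _)) (le_max_right _ _)
    rcases le_max_iff.1 this with h' | h' <;> omega

theorem hierDist_add_right_le {x h : HierGroup N} {k : ℕ} :
    hierDist x (x + h) ≤ k ↔ ∀ i, k ≤ i → h i = 0 := by
  rw [hierDist_le_iff]
  refine forall₂_congr fun i _ => ?_
  simp

variable [NeZero N]

/-- The ball of radius `k` around `x`. -/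
noncomputable def hierBall (k : ℕ) (x : HierGroup N) : Finset (HierGroup N) :=
  ((Finset.range k).finsupp (fun _ => (Finset.univ : Finset (ZMod N)))).map (addLeftEmbedding x)

theorem mem_hierBall {k : ℕ} {x y : HierGroup N} : y ∈ hierBall k x ↔ hierDist x y ≤ k := by
  unfold hierBall
  rw [Finset.mem_map]
  constructor
  · rintro ⟨h, hh, rfl⟩
    rw [Finset.mem_finsupp_iff] at hh
    change hierDist x (x + h) ≤ k
    rw [hierDist_add_right_le]
    intro i hi
    by_contra hne
    have := hh.1 (Finsupp.mem_support_iff.2 hne)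
    simp at this
    omega
  · intro h
    refine ⟨y - x, ?_, by simp⟩
    rw [Finset.mem_finsupp_iff]
    refine ⟨fun i hi => ?_, by simp⟩
    rw [Finset.mem_range]
    by_contra hlt
    rw [Finsupp.mem_support_iff, Finsupp.sub_apply, hierDist_le_iff.1 h i (by omega)] at hi
    simp at hi

theorem card_hierBall (k : ℕ) (x : HierGroup N) : (hierBall k x).card = N ^ k := by
  simp [hierBall, Finset.card_finsupp, ZMod.card]

theorem self_mem_hierBall (k : ℕ) (x : HierGroup N) : x ∈ hierBall k x :=
  mem_hierBall.2 (by simp [hierDist_self])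

theorem hierBall_mono {k l : ℕ} (h : k ≤ l) (x : HierGroup N) : hierBall k x ⊆ hierBall l x :=
  fun _ hy => mem_hierBall.2 ((mem_hierBall.1 hy).trans h)

/-- Representatives of the balls of radius `k` contained in the ball of radius `l` around `x`. -/
noncomputable def ballReps (k l : ℕ) (x : HierGroup N) : Finset (HierGroup N) :=
  ((Finset.Ico k l).finsupp (fun _ => (Finset.univ : Finset (ZMod N)))).map (addLeftEmbedding x)

theorem card_ballReps (k l : ℕ) (x : HierGroup N) : (ballReps k l x).card = N ^ (l - k) := by
  simp [ballReps, Finset.card_finsupp, ZMod.card]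

theorem mem_ballReps {k l : ℕ} {x y : HierGroup N} :
    y ∈ ballReps k l x ↔ hierDist x y ≤ l ∧ ∀ i < k, x i = y i := by
  unfold ballReps
  rw [Finset.mem_map]
  constructor
  · rintro ⟨h, hh, rfl⟩
    rw [Finset.mem_finsupp_iff] at hh
    change hierDist x (x + h) ≤ l ∧ ∀ i < k, x i = (x + h) i
    rw [hierDist_add_right_le]
    have key : ∀ i, ¬ (k ≤ i ∧ i < l) → h i = 0 := by
      intro i hi
      by_contra hne
      have := hh.1 (Finsupp.mem_support_iff.2 hne)
      simp at this
      omega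
    exact ⟨fun i hi => key i (by omega), fun i hi => by simp [key i (by omega)]⟩
  · rintro ⟨h, h'⟩
    refine ⟨y - x, ?_, by simp⟩
    rw [Finset.mem_finsupp_iff]
    refine ⟨fun i hi => ?_, by simp⟩
    rw [Finset.mem_Ico]
    rw [Finsupp.mem_support_iff, Finsupp.sub_apply] at hi
    by_contra hlt
    rw [not_and_or, not_le, not_lt] at hlt
    rcases hlt with hlt | hlt
    · rw [h' i hlt] at hi
      simp at hi
    · rw [hierDist_le_iff.1 h i hlt] at hi
      simp at hi

theorem exists_mem_ballReps (k : ℕ) {l : ℕ} {x y : HierGroup N} (h : hierDist x y ≤ l) :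
    ∃ z ∈ ballReps k l x, hierDist z y ≤ k := by
  -- The representative has the coordinates of `x` below `k` and those of `y` from `k` on.
  refine ⟨x + (y - x).filter (fun i => k ≤ i), mem_ballReps.2 ⟨?_, ?_⟩, ?_⟩
  · rw [hierDist_add_right_le]
    intro i hi
    rw [Finsupp.filter_apply, Finsupp.sub_apply, hierDist_le_iff.1 h i hi]
    simp
  · intro i hi
    simp [not_le.2 hi]
  · rw [hierDist_le_iff]
    intro i hi
    simp [hi]

theorem lt_hierDist_of_mem_ballReps {k l : ℕ} {x y z : HierGroup N} (hy : y ∈ ballReps k l x)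
    (hz : z ∈ ballReps k l x) (hne : y ≠ z) : k < hierDist y z := by
  by_contra! hle
  apply hne
  ext i
  rcases lt_or_ge i k with hi | hi
  · rw [← (mem_ballReps.1 hy).2 i hi, (mem_ballReps.1 hz).2 i hi]
  · rw [hierDist_le_iff.1 hle i hi]

/-- The number of points at distance `k ≥ 1` from a given point. -/
theorem card_sphere {k : ℕ} {s : Finset (HierGroup N)} {x : HierGroup N}
    (hs : ∀ y ∈ s, hierDist x y = k + 1) : s.card ≤ N ^ (k + 1) - N ^ k := by
  classical
  have h1 : s ⊆ hierBall (k + 1) x \ hierBall k x := by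
    intro y hy
    rw [Finset.mem_sdiff, mem_hierBall, mem_hierBall, hs y hy]
    omega
  refine (Finset.card_le_card h1).trans ?_
  rw [Finset.card_sdiff_of_subset (hierBall_mono (Nat.le_succ k) x), card_hierBall, card_hierBall]

/-- The exact sphere size `N^j - N^(j-1)` is kept here: bounding it by `N^j` would spoil the sharp
condition `C₁ < N`. -/
theorem sum_hierDist_le {k l : ℕ} (x : HierGroup N) {s : Finset (HierGroup N)}
    (hs : ∀ y ∈ s, k < hierDist x y ∧ hierDist x y ≤ l) (f : ℕ → ℝ) (hf : ∀ j, k < j → 0 ≤ f j) :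
    ∑ y ∈ s, f (hierDist x y) ≤ ∑ j ∈ Finset.Ioc k l, ((N : ℝ) ^ j - (N : ℝ) ^ (j - 1)) * f j := by
  classical
  rw [← Finset.sum_fiberwise_of_maps_to (s := s) (t := Finset.Ioc k l) (g := fun y => hierDist x y)
    (fun y hy => Finset.mem_Ioc.2 (hs y hy))]
  refine Finset.sum_le_sum fun j hj => ?_
  rw [Finset.mem_Ioc] at hj
  have h1 : ∑ y ∈ s with hierDist x y = j, f (hierDist x y)
      = ((s.filter (fun y => hierDist x y = j)).card : ℝ) * f j := by
    rw [Finset.sum_congr rfl (fun y hy => by rw [(Finset.mem_filter.1 hy).2])]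
    simp
  rw [h1]
  refine mul_le_mul_of_nonneg_right ?_ (hf j hj.1)
  obtain ⟨i, rfl⟩ : ∃ i, j = i + 1 := ⟨j - 1, by omega⟩
  have h2 := card_sphere (k := i) (s := s.filter (fun y => hierDist x y = i + 1)) (x := x)
    (fun y hy => (Finset.mem_filter.1 hy).2)
  have h3 : N ^ i ≤ N ^ (i + 1) := Nat.pow_le_pow_right (Nat.pos_of_ne_zero (NeZero.ne N)) (by omega)
  have h4 : ((N ^ (i + 1) - N ^ i : ℕ) : ℝ) = (N : ℝ) ^ (i + 1) - (N : ℝ) ^ (i + 1 - 1) := by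
    rw [Nat.cast_sub h3]
    push_cast
    simp
  rw [← h4]
  exact_mod_cast h2

/-- The crude count, with the whole ball in place of the sphere, suffices wherever constants do not
matter. -/
theorem tsum_hierDist_le (x : HierGroup N) (k : ℕ) (f : ℕ → ENNReal) :
    ∑' y : HierGroup N, (if k < hierDist x y then f (hierDist x y) else 0) ≤
      ∑' j : ℕ, (N : ENNReal) ^ (k + 1 + j) * f (k + 1 + j) := by
  have h0 : ∑' y : HierGroup N, (if k < hierDist x y then f (hierDist x y) else 0) ≤
      ∑' y : HierGroup N, ∑' j : ℕ, (if y ∈ hierBall (k + 1 + j) x then f (k + 1 + j) else 0) := by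
    refine ENNReal.tsum_le_tsum fun y => ?_
    split_ifs with hy
    · refine le_trans ?_ (ENNReal.le_tsum (hierDist x y - (k + 1)))
      have : k + 1 + (hierDist x y - (k + 1)) = hierDist x y := by omega
      rw [this, if_pos (mem_hierBall.2 le_rfl)]
    · exact zero_le
  refine h0.trans ?_
  rw [ENNReal.tsum_comm]
  refine ENNReal.tsum_le_tsum fun j => ?_
  rw [tsum_eq_sum (s := hierBall (k + 1 + j) x) (fun y hy => if_neg hy),
    Finset.sum_congr rfl (fun y hy => if_pos hy)]
  simp [card_hierBall]

end Geometry

/-! ### Events depending on finitely or infinitely many prescribed labels; independence -/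

section Locality

variable {N : ℕ}

instance : Countable (HierGroup N) := by
  have : Countable (ZMod N) := by
    cases N
    · exact inferInstanceAs (Countable ℤ)
    · exact inferInstanceAs (Countable (Fin _))
  infer_instance

instance : Countable (Sym2 (HierGroup N)) := Quotient.countable

instance : IsProbabilityMeasure (labelLaw N) := by
  unfold labelLaw
  infer_instance

/-- The σ-algebra generated by the labels of the pairs in `E`. -/
@[reducible]
def labelSigma (E : Set (Sym2 (HierGroup N))) : MeasurableSpace (EdgeLabels N) :=
  ⨆ e ∈ E, MeasurableSpace.comap (fun U : EdgeLabels N => U e) inferInstance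

/-- A property of the labels that is measurable with respect to the labels of the pairs in `E`. -/
def LocalOn (E : Set (Sym2 (HierGroup N))) (P : EdgeLabels N → Prop) : Prop :=
  MeasurableSet[labelSigma E] {U | P U}

theorem labelSigma_mono {E E' : Set (Sym2 (HierGroup N))} (h : E ⊆ E') :
    labelSigma E ≤ labelSigma E' :=
  biSup_mono fun _ he => h he

theorem labelSigma_le (E : Set (Sym2 (HierGroup N))) :
    labelSigma E ≤ (inferInstance : MeasurableSpace (EdgeLabels N)) :=
  iSup₂_le fun e _ => (measurable_pi_apply e).comap_le

variable {E E' : Set (Sym2 (HierGroup N))} {P Q : EdgeLabels N → Prop}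

theorem LocalOn.mono (hP : LocalOn E P) (h : E ⊆ E') : LocalOn E' P :=
  labelSigma_mono h _ hP

theorem LocalOn.measurableSet (hP : LocalOn E P) : MeasurableSet {U | P U} :=
  labelSigma_le E _ hP

theorem LocalOn.not (hP : LocalOn E P) : LocalOn E fun U => ¬ P U :=
  MeasurableSet.compl (m := labelSigma E) hP

theorem LocalOn.and (hP : LocalOn E P) (hQ : LocalOn E Q) : LocalOn E fun U => P U ∧ Q U :=
  @MeasurableSet.inter _ (labelSigma E) _ _ hP hQ

theorem LocalOn.or (hP : LocalOn E P) (hQ : LocalOn E Q) : LocalOn E fun U => P U ∨ Q U :=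
  @MeasurableSet.union _ (labelSigma E) _ _ hP hQ

theorem LocalOn.imp (hP : LocalOn E P) (hQ : LocalOn E Q) : LocalOn E fun U => P U → Q U := by
  simpa only [imp_iff_not_or] using hP.not.or hQ

theorem LocalOn.const (p : Prop) : LocalOn E fun _ => p :=
  @MeasurableSet.const _ (labelSigma E) p

theorem LocalOn.exists {ι : Sort*} [Countable ι] {P : ι → EdgeLabels N → Prop}
    (h : ∀ i, LocalOn E (P i)) : LocalOn E fun U => ∃ i, P i U := by
  have := @MeasurableSet.iUnion _ _ (labelSigma E) _ _ h
  unfold LocalOn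
  convert this using 1
  ext U
  simp

theorem LocalOn.forall {ι : Sort*} [Countable ι] {P : ι → EdgeLabels N → Prop}
    (h : ∀ i, LocalOn E (P i)) : LocalOn E fun U => ∀ i, P i U := by
  have := @MeasurableSet.iInter _ _ (labelSigma E) _ _ h
  unfold LocalOn
  convert this using 1
  ext U
  simp

theorem LocalOn.exists_mem {ι : Type*} [Countable ι] {S : Set ι} {P : ι → EdgeLabels N → Prop}
    (h : ∀ i ∈ S, LocalOn E (P i)) : LocalOn E fun U => ∃ i ∈ S, P i U := by
  refine LocalOn.exists fun i => ?_
  by_cases hi : i ∈ S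
  · simpa [hi] using h i hi
  · simpa [hi] using LocalOn.const False

theorem LocalOn.forall_mem {ι : Type*} [Countable ι] {S : Set ι} {P : ι → EdgeLabels N → Prop}
    (h : ∀ i ∈ S, LocalOn E (P i)) : LocalOn E fun U => ∀ i ∈ S, P i U := by
  refine LocalOn.forall fun i => ?_
  by_cases hi : i ∈ S
  · simpa [hi] using h i hi
  · simpa [hi] using LocalOn.const True

/-- Disjoint families of independent labels generate independent σ-algebras. Every use of
independence below reduces to finding disjoint sets of pairs on which two events are local. -/
theorem prob_and_of_disjoint (hP : LocalOn E P) (hQ : LocalOn E' Q) (h : Disjoint E E') :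
    labelLaw N {U | P U ∧ Q U} = labelLaw N {U | P U} * labelLaw N {U | Q U} := by
  have h1 := ProbabilityTheory.iIndepFun_infinitePi
    (P := fun _ : Sym2 (HierGroup N) => (volume : Measure unitInterval))
    (X := fun _ u => u) (fun _ => measurable_id)
  have h2 := ProbabilityTheory.indep_iSup_of_disjoint
    (fun e => (measurable_pi_apply (X := fun _ : Sym2 (HierGroup N) => unitInterval) e).comap_le)
    ((ProbabilityTheory.iIndepFun_iff_iIndep _ _ _).1 h1) h
  exact (ProbabilityTheory.Indep_iff _ _ _).1 h2 _ _ hP hQ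

/-- Decoupling: if the mutually exclusive events `A i` only depend on the labels in `E`, each `B i`
does not depend on the labels in `E`, and each `B i` has probability at most `ε`, then
`A i ∧ B i` happens for some `i` with probability at most `ε` times that of `A i` for some `i`. -/
theorem prob_exists_and_le {ι : Type*} [Countable ι] {A B : ι → EdgeLabels N → Prop}
    {E' : ι → Set (Sym2 (HierGroup N))} {ε : ENNReal}
    (hA : ∀ i, LocalOn E (A i)) (hB : ∀ i, LocalOn (E' i) (B i)) (hd : ∀ i, Disjoint E (E' i))
    (hex : ∀ i j U, A i U → A j U → i = j)
    (hε : ∀ i, (∃ U, A i U) → labelLaw N {U | B i U} ≤ ε) :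
    labelLaw N {U | ∃ i, A i U ∧ B i U} ≤ ε * labelLaw N {U | ∃ i, A i U} := by
  have h1 : {U | ∃ i, A i U ∧ B i U} = ⋃ i, {U | A i U ∧ B i U} := by ext; simp
  have h2 : {U | ∃ i, A i U} = ⋃ i, {U | A i U} := by ext; simp
  have h3 : labelLaw N (⋃ i, {U | A i U}) = ∑' i, labelLaw N {U | A i U} :=
    measure_iUnion (fun i j hij => Set.disjoint_left.2 fun U hi hj => hij (hex i j U hi hj))
      (fun i => (hA i).measurableSet)
  rw [h1, h2, h3, ← ENNReal.tsum_mul_left]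
  refine (measure_iUnion_le _).trans ?_
  refine ENNReal.tsum_le_tsum fun i => ?_
  rw [prob_and_of_disjoint (hA i) (hB i) (hd i), mul_comm]
  by_cases hi : ∃ U, A i U
  · gcongr
    exact hε i hi
  · have : {U | A i U} = ∅ := by
      ext U
      simpa using fun h => hi ⟨U, h⟩
    simp [this]

/-- The pairs of points of `B`. -/
def insidePairs (B : Set (HierGroup N)) : Set (Sym2 (HierGroup N)) := {e | ∀ v ∈ e, v ∈ B}

/-- The pairs with at least one point in `B`. -/
def touchingPairs (B : Set (HierGroup N)) : Set (Sym2 (HierGroup N)) := {e | ∃ v ∈ e, v ∈ B}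

theorem mk_mem_insidePairs {B : Set (HierGroup N)} {x y : HierGroup N} :
    s(x, y) ∈ insidePairs B ↔ x ∈ B ∧ y ∈ B := by
  simp [insidePairs]

theorem mk_mem_touchingPairs {B : Set (HierGroup N)} {x y : HierGroup N} :
    s(x, y) ∈ touchingPairs B ↔ x ∈ B ∨ y ∈ B := by
  simp [touchingPairs]

theorem insidePairs_mono {B B' : Set (HierGroup N)} (h : B ⊆ B') :
    insidePairs B ⊆ insidePairs B' := fun _ he v hv => h (he v hv)

theorem insidePairs_subset_touchingPairs (B : Set (HierGroup N)) :
    insidePairs B ⊆ touchingPairs B := by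
  intro e
  induction e with
  | h x y => rw [mk_mem_insidePairs, mk_mem_touchingPairs]; tauto

theorem disjoint_touchingPairs_insidePairs {B B' : Set (HierGroup N)} (h : Disjoint B B') :
    Disjoint (touchingPairs B) (insidePairs B') := by
  rw [Set.disjoint_left]
  rintro e ⟨v, hv, hvB⟩ he
  exact Set.disjoint_left.1 h hvB (he v hv)

theorem disjoint_insidePairs {B B' : Set (HierGroup N)} (h : Disjoint B B') :
    Disjoint (insidePairs B) (insidePairs B') :=
  (disjoint_touchingPairs_insidePairs h).mono_left (insidePairs_subset_touchingPairs B)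

/-- The pairs of points of the ball of radius `k` around `x`. -/
def ballPairs (k : ℕ) (x : HierGroup N) : Set (Sym2 (HierGroup N)) :=
  insidePairs {y | hierDist x y ≤ k}

theorem mk_mem_ballPairs {k : ℕ} {x y z : HierGroup N} :
    s(y, z) ∈ ballPairs k x ↔ hierDist x y ≤ k ∧ hierDist x z ≤ k :=
  mk_mem_insidePairs

theorem ballPairs_mono {k l : ℕ} {x y : HierGroup N} (hkl : k ≤ l) (h : hierDist x y ≤ l) :
    ballPairs k y ⊆ ballPairs l x :=
  insidePairs_mono fun _ hz => hierDist_trans_le h (le_trans hz hkl)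

theorem disjoint_balls {k l : ℕ} {x y : HierGroup N} (h : max k l < hierDist x y) :
    Disjoint {z | hierDist x z ≤ k} {z | hierDist y z ≤ l} := by
  rw [Set.disjoint_left]
  intro z hz hz'
  refine absurd (hierDist_trans_le (k := max k l) (le_trans hz (le_max_left _ _)) ?_) (not_le.2 h)
  rw [hierDist_comm]
  exact le_trans hz' (le_max_right _ _)

theorem disjoint_ballPairs {k l : ℕ} {x y : HierGroup N} (h : max k l < hierDist x y) :
    Disjoint (ballPairs k x) (ballPairs l y) :=
  disjoint_insidePairs (disjoint_balls h)

end Locality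

/-! ### Probabilities of edges and of their absence -/

section Edges

variable {N : ℕ} {δ : ℝ} {c : ℕ → ℝ}

theorem localOn_adj {E : Set (Sym2 (HierGroup N))} {x y : HierGroup N} (h : s(x, y) ∈ E) :
    LocalOn E fun U => (hierGraph N δ c U).Adj x y := by
  refine (LocalOn.const (x ≠ y)).and ?_
  have h1 : MeasurableSet[MeasurableSpace.comap (fun U : EdgeLabels N => U s(x, y)) inferInstance]
      {U | ((U s(x, y) : unitInterval) : ℝ) ≤ connProb N δ c (hierDist x y)} :=
    ⟨{t | (t : ℝ) ≤ connProb N δ c (hierDist x y)},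
      measurableSet_le measurable_subtype_coe measurable_const, rfl⟩
  have h2 : MeasurableSpace.comap (fun U : EdgeLabels N => U s(x, y)) inferInstance ≤
      labelSigma E := le_iSup₂_of_le s(x, y) h le_rfl
  exact h2 _ h1

theorem measurableSet_adj (x y : HierGroup N) :
    MeasurableSet {U | (hierGraph N δ c U).Adj x y} :=
  (localOn_adj (Set.mem_univ _)).measurableSet

theorem prob_adj {x y : HierGroup N} (hxy : x ≠ y) (h0 : 0 ≤ connProb N δ c (hierDist x y)) :
    labelLaw N {U | (hierGraph N δ c U).Adj x y} =
      ENNReal.ofReal (connProb N δ c (hierDist x y)) := by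
  have h1 : connProb N δ c (hierDist x y) ≤ 1 := min_le_right _ _
  have h2 : {U | (hierGraph N δ c U).Adj x y} =
      (fun U : EdgeLabels N => U s(x, y)) ⁻¹' Set.Iic ⟨_, h0, h1⟩ := by
    ext U
    simp only [hierGraph, Set.mem_preimage, Set.mem_Iic, ← Subtype.coe_le_coe]
    exact and_iff_right hxy
  rw [h2, labelLaw, (measurePreserving_eval_infinitePi
    (fun _ : Sym2 (HierGroup N) => (volume : Measure unitInterval)) s(x, y)).measure_preimage
      measurableSet_Iic.nullMeasurableSet, unitInterval.volume_Iic]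

theorem prob_adj_le (x y : HierGroup N) (h0 : x ≠ y → 0 ≤ connProb N δ c (hierDist x y)) :
    labelLaw N {U | (hierGraph N δ c U).Adj x y} ≤
      ENNReal.ofReal (connProb N δ c (hierDist x y)) := by
  by_cases hxy : x = y
  · subst hxy
    simp
  · exact (prob_adj hxy (h0 hxy)).le

theorem prob_not_adj {x y : HierGroup N} (hxy : x ≠ y)
    (h0 : 0 ≤ connProb N δ c (hierDist x y)) :
    labelLaw N {U | ¬ (hierGraph N δ c U).Adj x y} =
      ENNReal.ofReal (1 - connProb N δ c (hierDist x y)) := by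
  have h := prob_compl_eq_one_sub (μ := labelLaw N) (measurableSet_adj (δ := δ) (c := c) x y)
  rw [prob_adj hxy h0] at h
  rw [ENNReal.ofReal_sub _ h0, ENNReal.ofReal_one, ← h]
  rfl

/-- Injectivity of `p ↦ s(p.1, p.2)` ensures that no label is used twice, so the probabilities
multiply. -/
theorem prob_forall_not_adj_pairs (F : Finset (HierGroup N × HierGroup N))
    (hinj : Set.InjOn (fun p : HierGroup N × HierGroup N => s(p.1, p.2)) F)
    (hne : ∀ p ∈ F, p.1 ≠ p.2) (h0 : ∀ p ∈ F, 0 ≤ connProb N δ c (hierDist p.1 p.2)) :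
    labelLaw N {U | ∀ p ∈ F, ¬ (hierGraph N δ c U).Adj p.1 p.2} =
      ∏ p ∈ F, ENNReal.ofReal (1 - connProb N δ c (hierDist p.1 p.2)) := by
  classical
  induction F using Finset.induction_on with
  | empty => simp
  | insert a F ha ih =>
    rw [Finset.prod_insert ha, ← ih (hinj.mono (by simp)) (fun p hp => hne p (by simp [hp]))
      (fun p hp => h0 p (by simp [hp])),
      ← prob_not_adj (hne a (by simp)) (h0 a (by simp))]
    have hloc : LocalOn ((fun p : HierGroup N × HierGroup N => s(p.1, p.2)) '' ↑F)
        fun U => ∀ p ∈ F, ¬ (hierGraph N δ c U).Adj p.1 p.2 :=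
by
      refine LocalOn.forall_mem (S := {p | p ∈ F}) fun p hp => LocalOn.not (localOn_adj ?_)
      exact ⟨p, hp, rfl⟩
    have hloca : LocalOn {s(a.1, a.2)} fun U => ¬ (hierGraph N δ c U).Adj a.1 a.2 :=
      (localOn_adj (Set.mem_singleton _)).not
    rw [← prob_and_of_disjoint hloca hloc ?_]
    · congr 1
      ext U
      simp
    · rw [Set.disjoint_singleton_left]
      rintro ⟨p, hp, hpa⟩
      have : p = a := hinj (by simp [Finset.mem_coe.1 hp]) (by simp) hpa
      exact ha (this ▸ hp)

theorem prob_forall_not_adj {S T : Finset (HierGroup N)} (hd : Disjoint S T)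
    (h0 : ∀ x ∈ S, ∀ y ∈ T, 0 ≤ connProb N δ c (hierDist x y)) :
    labelLaw N {U | ∀ x ∈ S, ∀ y ∈ T, ¬ (hierGraph N δ c U).Adj x y} =
      ENNReal.ofReal (∏ x ∈ S, ∏ y ∈ T, (1 - connProb N δ c (hierDist x y))) := by
  have h := prob_forall_not_adj_pairs (δ := δ) (c := c) (S ×ˢ T) ?_ ?_ ?_
  · rw [← Finset.prod_product', ENNReal.ofReal_prod_of_nonneg, ← h]
    · congr 1
      ext U
      simp only [Finset.mem_product, and_imp, Prod.forall]
      exact ⟨fun h a b ha hb => h a ha b hb, fun h a ha b hb => h a b ha hb⟩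
    · intro p hp
      exact sub_nonneg.2 (min_le_right _ _)
  · rintro ⟨a, b⟩ hab ⟨a', b'⟩ hab' heq
    simp only [Finset.coe_product, Set.mem_prod, Finset.mem_coe] at hab hab'
    rcases Sym2.eq_iff.1 heq with ⟨h1, h2⟩ | ⟨h1, h2⟩
    · exact Prod.ext h1 h2
    · exact absurd (show b' ∈ S from (show a = b' from h1) ▸ hab.1)
        (fun h => Finset.disjoint_left.1 hd h hab'.2)
  · rintro ⟨a, b⟩ hab heq
    rw [Finset.mem_product] at hab
    exact Finset.disjoint_left.1 hd hab.1 (by rw [show a = b from heq]; exact hab.2)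
  · rintro ⟨a, b⟩ hab
    rw [Finset.mem_product] at hab
    exact h0 a hab.1 b hab.2

theorem one_sub_connProb_le {k : ℕ} :
    1 - connProb N δ c k ≤ Real.exp (-(c k / (N : ℝ) ^ ((k : ℝ) * (1 + δ)))) := by
  unfold connProb
  rcases min_cases (c k / (N : ℝ) ^ ((k : ℝ) * (1 + δ))) 1 with h | h
  · rw [h.1]
    linarith [Real.add_one_le_exp (-(c k / (N : ℝ) ^ ((k : ℝ) * (1 + δ))))]
  · rw [h.1, sub_self]
    exact (Real.exp_pos _).le

theorem connProb_nonneg {k : ℕ} (h : 0 ≤ c k) : 0 ≤ connProb N δ c k := by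
  unfold connProb
  positivity

theorem connProb_one_le (k : ℕ) : connProb N 1 c k ≤ c k / (N : ℝ) ^ (2 * k) := by
  refine (min_le_left _ _).trans (le_of_eq ?_)
  rw [← Real.rpow_natCast]
  congr 2
  push_cast
  ring

end Edges

/-! ### Path counting when the expected degree is below one -/

section Subcritical

variable {N : ℕ} {δ : ℝ} {c : ℕ → ℝ}

/-- There is a self-avoiding path with `n` edges from `x` to `y` that avoids `S` after its start. -/
def AvoidingPath (δ : ℝ) (c : ℕ → ℝ) (U : EdgeLabels N) :
    ℕ → Set (HierGroup N) → HierGroup N → HierGroup N → Prop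
  | 0, _, x, y => x = y
  | n + 1, S, x, y => ∃ z, z ∉ insert x S ∧ (hierGraph N δ c U).Adj x z ∧
      AvoidingPath δ c U n (insert x S) z y

theorem localOn_avoidingPath (n : ℕ) (S : Set (HierGroup N)) (x y : HierGroup N) (hx : x ∉ S) :
    LocalOn (insidePairs Sᶜ) fun U => AvoidingPath δ c U n S x y := by
  induction n generalizing S x with
  | zero => exact LocalOn.const _
  | succ n ih =>
    refine LocalOn.exists_mem (S := (insert x S)ᶜ) fun z hz => ?_
    have hzS : z ∉ S := fun h => hz (Set.mem_insert_of_mem _ h)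
    have hxz : s(x, z) ∈ insidePairs Sᶜ := mk_mem_insidePairs.2 ⟨hx, hzS⟩
    refine (localOn_adj hxz).and ?_
    exact (ih (insert x S) z hz).mono
      (insidePairs_mono (Set.compl_subset_compl.2 (Set.subset_insert _ _)))

/-- Decompose by the first step `x → z`. The rest of the path avoids `x`, hence uses no label of a
pair containing `x`, so it is independent of the edge `{x, z}`. Each step therefore contributes a
factor `m`. -/
theorem tsum_prob_avoidingPath_le {m : ENNReal}
    (hm : ∀ x, ∑' z, labelLaw N {U | (hierGraph N δ c U).Adj x z} ≤ m)
    (n : ℕ) (S : Set (HierGroup N)) (x : HierGroup N) (hx : x ∉ S) :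
    ∑' y, labelLaw N {U | AvoidingPath δ c U n S x y} ≤ m ^ n := by
  classical
  induction n generalizing S x with
  | zero =>
    rw [tsum_eq_single x]
    · simp [AvoidingPath]
    · intro y hy
      simp [AvoidingPath, hy.symm]
  | succ n ih =>
    have h1 : ∀ y, labelLaw N {U | AvoidingPath δ c U (n + 1) S x y} ≤
        ∑' z, if z ∈ insert x S then 0 else labelLaw N {U | (hierGraph N δ c U).Adj x z} *
          labelLaw N {U | AvoidingPath δ c U n (insert x S) z y} := by
      intro y
      have h2 : {U | AvoidingPath δ c U (n + 1) S x y} = ⋃ z, {U | z ∉ insert x S ∧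
          (hierGraph N δ c U).Adj x z ∧ AvoidingPath δ c U n (insert x S) z y} := by
        ext U
        simp only [AvoidingPath, Set.mem_ofPred_eq, Set.mem_iUnion]
      rw [h2]
      refine (measure_iUnion_le _).trans (ENNReal.tsum_le_tsum fun z => ?_)
      split_ifs with hz
      · simp [hz]
      · simp only [hz, not_false_eq_true, true_and]
        refine (prob_and_of_disjoint (localOn_adj (E := {s(x, z)}) rfl)
          (localOn_avoidingPath n (insert x S) z y hz) ?_).le
        rw [Set.disjoint_singleton_left, mk_mem_insidePairs]
        simp
    refine (ENNReal.tsum_le_tsum h1).trans ?_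
    rw [ENNReal.tsum_comm, pow_succ']
    refine le_trans ?_ (mul_le_mul_left (hm x) _)
    rw [← ENNReal.tsum_mul_right]
    refine ENNReal.tsum_le_tsum fun z => ?_
    by_cases hz : z ∈ insert x S
    · simp [hz]
    · simp only [hz, if_false]
      rw [ENNReal.tsum_mul_left]
      gcongr
      exact ih _ _ hz

theorem avoidingPath_of_isPath {U : EdgeLabels N} {S : Set (HierGroup N)} {x y : HierGroup N}
    (w : (hierGraph N δ c U).Walk x y) (hw : w.IsPath) (hS : ∀ v ∈ w.support, v ∉ S) :
    AvoidingPath δ c U w.length S x y := by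
  induction w generalizing S with
  | nil => rfl
  | @cons x z y h p ih =>
    rw [SimpleGraph.Walk.cons_isPath_iff] at hw
    have hsup : ∀ v ∈ p.support, v ∉ insert x S := by
      intro v hv hvS
      rcases hvS with rfl | hvS
      · exact hw.2 hv
      · exact hS v (by simp [hv]) hvS
    exact ⟨z, hsup z p.start_mem_support, h, ih hw.1 hsup⟩

/-- If the expected degree is less than `1`, then all clusters are finite. -/
theorem not_percolates_of_degree_lt {m : ENNReal} (hm1 : m < 1)
    (hm : ∀ x : HierGroup N, ∑' z, labelLaw N {U | (hierGraph N δ c U).Adj x z} ≤ m) :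
    ¬ Percolates N δ c := by
  unfold Percolates
  rw [not_lt, nonpos_iff_eq_zero]
  -- A finite expected number of endpoints, counted with path length, lets Borel–Cantelli leave only
  -- finitely many pairs `(n, y)`. Each point of the cluster is the end of some self-avoiding path.
  have h1 : ∑' q : ℕ × HierGroup N, labelLaw N {U | AvoidingPath δ c U q.1 ∅ 0 q.2} ≠ ⊤ := by
    rw [ENNReal.tsum_prod (f := fun n y => labelLaw N {U | AvoidingPath δ c U n ∅ 0 y})]
    refine ne_top_of_le_ne_top ?_ (ENNReal.tsum_le_tsum fun n =>
      tsum_prob_avoidingPath_le hm n ∅ 0 (Set.notMem_empty _))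
    rw [ENNReal.tsum_geometric]
    exact ENNReal.inv_ne_top.2 (tsub_pos_of_lt hm1).ne'
  have h2 := ae_finite_setOfPred_mem h1
  rw [← compl_compl {U | _}]
  refine measure_mono_null ?_ h2
  intro U hU hfin
  rw [compl_compl] at hU
  refine hU ((hfin.image Prod.snd).subset ?_)
  intro y hy
  rw [SimpleGraph.ConnectedComponent.mem_supp_iff, SimpleGraph.ConnectedComponent.eq] at hy
  obtain ⟨w, hw⟩ := hy.symm.exists_isPath
  exact ⟨(w.length, y), avoidingPath_of_isPath w hw (by simp), rfl⟩

end Subcritical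

/-! ### Expected degrees and part (c) -/

section Degree

variable {N : ℕ} {c : ℕ → ℝ}

theorem tsum_prob_adj_far_le [NeZero N] (hc : ∀ k, 1 ≤ k → 0 ≤ c k) (x : HierGroup N) (k : ℕ) :
    ∑' z, labelLaw N {U | k < hierDist x z ∧ (hierGraph N 1 c U).Adj x z} ≤
      ∑' j : ℕ, ENNReal.ofReal (c (k + 1 + j) / (N : ℝ) ^ (k + 1 + j)) := by
  have h1 : ∀ z : HierGroup N, labelLaw N {U | k < hierDist x z ∧ (hierGraph N 1 c U).Adj x z} ≤
      if k < hierDist x z then ENNReal.ofReal (connProb N 1 c (hierDist x z)) else 0 := by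
    intro z
    split_ifs with hz
    · simp only [hz, true_and]
      exact prob_adj_le x z fun _ => connProb_nonneg (hc _ (by omega))
    · simp [hz]
  refine (ENNReal.tsum_le_tsum h1).trans ((tsum_hierDist_le x k
    fun j => ENNReal.ofReal (connProb N 1 c j)).trans
    (ENNReal.tsum_le_tsum fun j => ?_))
  have hN : (0 : ℝ) < N := by exact_mod_cast Nat.pos_of_ne_zero (NeZero.ne N)
  rw [← ENNReal.ofReal_natCast, ← ENNReal.ofReal_pow hN.le, ← ENNReal.ofReal_mul (by positivity)]
  refine ENNReal.ofReal_le_ofReal ?_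
  refine (mul_le_mul_of_nonneg_left (connProb_one_le _) (by positivity)).trans (le_of_eq ?_)
  rw [pow_mul', sq]
  field_simp

theorem summable_pow_div_pow (hN : 2 ≤ N) (r : ℕ) :
    Summable fun j : ℕ => (j : ℝ) ^ r / (N : ℝ) ^ j := by
  have hN' : (2 : ℝ) ≤ N := by exact_mod_cast hN
  have := summable_pow_mul_geometric_of_norm_lt_one r (r := (N : ℝ)⁻¹) (by
    rw [Real.norm_of_nonneg (by positivity)]
    exact inv_lt_one_of_one_lt₀ (by linarith))
  refine this.congr fun j => ?_
  rw [inv_pow, div_eq_mul_inv]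

theorem tsum_ofReal_rate_le (hN : 2 ≤ N) {A : ℝ} (hA : 0 ≤ A) {r : ℕ}
    (hc : ∀ k, 1 ≤ k → c k ≤ A * (k : ℝ) ^ r) :
    ∑' j : ℕ, ENNReal.ofReal (c (1 + j) / (N : ℝ) ^ (1 + j)) ≤
      ENNReal.ofReal (A * ∑' j : ℕ, (j : ℝ) ^ r / (N : ℝ) ^ j) := by
  have hs := summable_pow_div_pow hN r
  rw [← tsum_mul_left, ENNReal.ofReal_tsum_of_nonneg (fun j => by positivity) (hs.mul_left A)]
  refine le_trans ?_ (ENNReal.tsum_comp_le_tsum_of_injective (f := fun j : ℕ => 1 + j)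
    (fun a b h => by simpa using h) _)
  refine ENNReal.tsum_le_tsum fun j => ENNReal.ofReal_le_ofReal ?_
  rw [← mul_div_assoc]
  gcongr
  exact hc _ (by omega)

theorem criticalRate_nonneg {C₀ C₁ C₂ α : ℝ} (h0 : 0 ≤ C₀) (h1 : 0 ≤ C₁) (h2 : 0 ≤ C₂) (k : ℕ) :
    0 ≤ criticalRate C₀ C₁ C₂ α k := by
  unfold criticalRate
  have : 0 ≤ Real.log k := Real.log_natCast_nonneg k
  positivity

theorem criticalRate_le {C₀ C₁ C₂ α C : ℝ} (hC : 0 ≤ C) (h0 : C₀ ≤ C) (h1 : C₁ ≤ C) (h2 : C₂ ≤ C)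
    {r : ℕ} (hr : 1 ≤ r) (hα : α ≤ r) {k : ℕ} (hk : 1 ≤ k) :
    criticalRate C₀ C₁ C₂ α k ≤ 3 * C * (k : ℝ) ^ r := by
  unfold criticalRate
  have hk' : (1 : ℝ) ≤ k := by exact_mod_cast hk
  have e0 : (1 : ℝ) ≤ (k : ℝ) ^ r := one_le_pow₀ hk'
  have e1 : Real.log k ≤ (k : ℝ) ^ r :=
    (Real.log_le_self (by linarith)).trans (le_self_pow₀ hk' (by omega))
  have e2 : (k : ℝ) ^ α ≤ (k : ℝ) ^ r := by
    rw [← Real.rpow_natCast]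
    exact Real.rpow_le_rpow_of_exponent_le hk' hα
  have l0 : 0 ≤ Real.log k := Real.log_natCast_nonneg k
  have l2 : 0 ≤ (k : ℝ) ^ α := by positivity
  have a0 : C₀ * 1 ≤ C * (k : ℝ) ^ r := by nlinarith
  have a1 : C₁ * Real.log k ≤ C * (k : ℝ) ^ r := by nlinarith
  have a2 : C₂ * (k : ℝ) ^ α ≤ C * (k : ℝ) ^ r := by nlinarith
  linarith

theorem tsum_prob_adj_le [NeZero N] (hN : 2 ≤ N) (hc0 : ∀ k, 1 ≤ k → 0 ≤ c k) {A : ℝ} (hA : 0 ≤ A)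
    {r : ℕ} (hc : ∀ k, 1 ≤ k → c k ≤ A * (k : ℝ) ^ r) (x : HierGroup N) :
    ∑' z, labelLaw N {U | (hierGraph N 1 c U).Adj x z} ≤
      ENNReal.ofReal (A * ∑' j : ℕ, (j : ℝ) ^ r / (N : ℝ) ^ j) := by
  refine le_trans (le_of_eq ?_) ((tsum_prob_adj_far_le hc0 x 0).trans ?_)
  · refine tsum_congr fun z => ?_
    congr 1
    ext U
    refine ⟨fun h => ⟨?_, h⟩, fun h => h.2⟩
    rw [Nat.pos_iff_ne_zero, Ne, hierDist_eq_zero]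
    exact (show (hierGraph N 1 c U).Adj x z from h).ne
  · simpa only [zero_add] using tsum_ofReal_rate_le hN hA hc

theorem exists_not_percolates_of_small (hN : 2 ≤ N) (α : ℝ) :
    ∃ C' : ℝ, 0 < C' ∧ ∀ C₀ C₁ C₂ : ℝ, 0 ≤ C₀ → 0 ≤ C₁ → 0 ≤ C₂ → max C₀ (max C₁ C₂) < C' →
      ¬ Percolates N 1 (criticalRate C₀ C₁ C₂ α) := by
  have : NeZero N := ⟨by omega⟩
  obtain ⟨r, hr⟩ := exists_nat_ge (max 1 α)
  have hr1 : 1 ≤ r := by exact_mod_cast (le_max_left _ _).trans hr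
  set W : ℝ := ∑' j : ℕ, (j : ℝ) ^ r / (N : ℝ) ^ j with hW
  have hW0 : 0 ≤ W := tsum_nonneg fun j => by positivity
  refine ⟨1 / (3 * (W + 1)), by positivity, fun C₀ C₁ C₂ h0 h1 h2 hmax => ?_⟩
  have hC := hmax
  simp only [max_lt_iff] at hmax
  set C' := 1 / (3 * (W + 1)) with hC'
  have hC'0 : 0 < C' := by positivity
  refine not_percolates_of_degree_lt (m := ENNReal.ofReal (3 * C' * W)) ?_ (tsum_prob_adj_le hN
    (fun k _ => criticalRate_nonneg h0 h1 h2 k) (by positivity) fun k hk =>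
      criticalRate_le hC'0.le hmax.1.le hmax.2.1.le hmax.2.2.le hr1
        ((le_max_right _ _).trans hr) hk)
  rw [ENNReal.ofReal_lt_one, hC']
  rw [show 3 * (1 / (3 * (W + 1))) * W = W / (W + 1) by field_simp]
  rw [div_lt_one (by linarith)]
  linarith

end Degree

/-! ### Edges that jump far out of a ball -/

section LongEdges

variable {N : ℕ} {c : ℕ → ℝ}

theorem prob_long_edge_le [NeZero N] (hN : 2 ≤ N) (hc0 : ∀ k, 1 ≤ k → 0 ≤ c k) {A : ℝ} (hA : 0 ≤ A)
    {r : ℕ} (hc : ∀ k, 1 ≤ k → c k ≤ A * (k : ℝ) ^ r) (x : HierGroup N) (k l : ℕ) :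
    labelLaw N {U | ∃ u ∈ hierBall k x, ∃ v, l < hierDist u v ∧ (hierGraph N 1 c U).Adj u v} ≤
      ENNReal.ofReal (A * (∑' j : ℕ, (j : ℝ) ^ r / (N : ℝ) ^ j) * ((l : ℝ) + 1) ^ r *
        ((N : ℝ) ^ k / (N : ℝ) ^ l)) := by
  have hs := summable_pow_div_pow hN r
  have hN0 : (0 : ℝ) < N := by positivity
  set W : ℝ := ∑' j : ℕ, (j : ℝ) ^ r / (N : ℝ) ^ j with hW
  have h1 : ∀ u : HierGroup N, labelLaw N {U | ∃ v, l < hierDist u v ∧ (hierGraph N 1 c U).Adj u v} ≤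
      ENNReal.ofReal (A * W * ((l : ℝ) + 1) ^ r / (N : ℝ) ^ l) := by
    intro u
    have h2 : {U | ∃ v, l < hierDist u v ∧ (hierGraph N 1 c U).Adj u v} =
        ⋃ v, {U | l < hierDist u v ∧ (hierGraph N 1 c U).Adj u v} := by ext; simp
    rw [h2]
    refine (measure_iUnion_le _).trans ((tsum_prob_adj_far_le hc0 u l).trans ?_)
    have h3 : ∑' j : ℕ, ENNReal.ofReal (c (l + 1 + j) / (N : ℝ) ^ (l + 1 + j)) ≤
        ∑' j : ℕ, ENNReal.ofReal (A * ((l : ℝ) + 1) ^ r / (N : ℝ) ^ l *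
          (((1 + j : ℕ) : ℝ) ^ r / (N : ℝ) ^ (1 + j))) := by
      refine ENNReal.tsum_le_tsum fun j => ENNReal.ofReal_le_ofReal ?_
      -- This product bound separates the dependence on `l` from a convergent series in `j`.
      have h4 : ((l + 1 + j : ℕ) : ℝ) ≤ ((l : ℝ) + 1) * ((1 + j : ℕ) : ℝ) := by
        push_cast
        have : (0 : ℝ) ≤ (l : ℝ) * j := by positivity
        nlinarith
      have h5 : c (l + 1 + j) ≤ A * (((l : ℝ) + 1) * ((1 + j : ℕ) : ℝ)) ^ r :=
        (hc _ (by omega)).trans (by gcongr)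
      calc c (l + 1 + j) / (N : ℝ) ^ (l + 1 + j)
          ≤ A * (((l : ℝ) + 1) * ((1 + j : ℕ) : ℝ)) ^ r / (N : ℝ) ^ (l + 1 + j) := by gcongr
        _ = _ := by
          rw [mul_pow, add_assoc l 1 j, pow_add]
          field_simp
    refine h3.trans ?_
    have h6 := ENNReal.tsum_comp_le_tsum_of_injective (f := fun j : ℕ => 1 + j)
      (fun a b h => by simpa using h) (fun j : ℕ => ENNReal.ofReal (A * ((l : ℝ) + 1) ^ r /
        (N : ℝ) ^ l * ((j : ℝ) ^ r / (N : ℝ) ^ j)))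
    refine h6.trans (le_of_eq ?_)
    rw [← ENNReal.ofReal_tsum_of_nonneg (fun j => by positivity) (hs.mul_left _), tsum_mul_left]
    congr 1
    rw [← hW]
    ring
  have h7 : {U | ∃ u ∈ hierBall k x, ∃ v, l < hierDist u v ∧ (hierGraph N 1 c U).Adj u v} =
      ⋃ u ∈ hierBall k x, {U | ∃ v, l < hierDist u v ∧ (hierGraph N 1 c U).Adj u v} := by
    ext; simp
  rw [h7]
  refine (measure_biUnion_finset_le _ _).trans ((Finset.sum_le_sum fun u _ => h1 u).trans ?_)
  rw [Finset.sum_const, card_hierBall, nsmul_eq_mul, ← ENNReal.ofReal_natCast,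
    ← ENNReal.ofReal_mul (by positivity)]
  refine ENNReal.ofReal_le_ofReal (le_of_eq ?_)
  push_cast
  ring

end LongEdges

theorem SimpleGraph.supp_subset_of_forall_adj {V : Type*} {G : SimpleGraph V} {S : Set V} {x : V}
    (hx : x ∈ S) (h : ∀ u ∈ S, ∀ v, G.Adj u v → v ∈ S) :
    (G.connectedComponentMk x).supp ⊆ S := by
  intro y hy
  rw [SimpleGraph.ConnectedComponent.mem_supp_iff, SimpleGraph.ConnectedComponent.eq] at hy
  obtain ⟨w⟩ := hy.symm
  clear hy
  induction w with
  | nil => exact hx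
  | cons hadj _ ih => exact ih (h _ hx _ hadj)

/-- The weights are the expected numbers of edges per unit of rate leaving a ball; their total `1 /
N` is the source of the condition `C₁ < N`. -/
theorem sum_geometric_le {N : ℕ} (hN : 2 ≤ N) (n : ℕ) :
    ∑ i ∈ Finset.range n, (1 - 1 / (N : ℝ)) * (1 / (N : ℝ) ^ (i + 1)) ≤ 1 / N := by
  have hN0 : (0 : ℝ) < N := by positivity
  have h : ∑ i ∈ Finset.range n, (1 - 1 / (N : ℝ)) * (1 / (N : ℝ) ^ (i + 1)) =
      (1 - 1 / (N : ℝ) ^ n) / N := by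
    induction n with
    | zero => simp
    | succ n ih =>
      rw [Finset.sum_range_succ, ih]
      field_simp
      ring
  rw [h]
  gcongr
  have : (0 : ℝ) ≤ 1 / (N : ℝ) ^ n := by positivity
  linarith

/-! ### Logarithmic rates: isolated balls and part (b) -/

section Logarithmic

variable {N : ℕ} [NeZero N] {c : ℕ → ℝ}

/-- A converse to `1 - p ≤ exp (-p)` for small `p`, at the price of a factor `1 + η` arbitrarily
close to `1`. -/
theorem exp_neg_le_one_sub {p η : ℝ} (hη : 0 < η) (h0 : 0 ≤ p) (hp : p ≤ η / (1 + η)) :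
    Real.exp (-((1 + η) * p)) ≤ 1 - p := by
  have h1 : 0 < 1 - p := by
    have : η / (1 + η) < 1 := by rw [div_lt_one (by linarith)]; linarith
    linarith
  rw [← Real.le_log_iff_exp_le h1]
  refine le_trans ?_ (Real.one_sub_inv_le_log_of_pos h1)
  have h2 : (1 - p)⁻¹ ≤ 1 + η := by
    rw [inv_le_comm₀ h1 (by linarith)]
    have : (1 + η)⁻¹ = 1 - η / (1 + η) := by field_simp; ring
    linarith
  have h3 : 1 - (1 - p)⁻¹ = -(p * (1 - p)⁻¹) := by field_simp; ring
  rw [h3]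
  nlinarith

/-- No edge joins the ball of radius `k` around `0` to the annulus between the radii `k`, `l`. -/
def NoCrossing (c : ℕ → ℝ) (k l : ℕ) (U : EdgeLabels N) : Prop :=
  ∀ u ∈ hierBall k (0 : HierGroup N), ∀ v ∈ hierBall l (0 : HierGroup N) \ hierBall k 0,
    ¬ (hierGraph N 1 c U).Adj u v

theorem lt_hierDist_of_crossing {k l : ℕ} {u v x : HierGroup N} (hkl : k ≤ l)
    (hu : u ∈ hierBall k x) (hv : v ∉ hierBall l x) : l < hierDist u v := by
  rw [mem_hierBall] at hu hv
  by_contra! h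
  exact hv (hierDist_trans_le (hu.trans hkl) h)

theorem localOn_noCrossing_inside {k l : ℕ} (hkl : k ≤ l) :
    LocalOn (ballPairs l (0 : HierGroup N)) (NoCrossing c k l) :=
  LocalOn.forall_mem (S := {u | u ∈ hierBall k (0 : HierGroup N)}) fun _ hu =>
    LocalOn.forall_mem (S := {v | v ∈ hierBall l (0 : HierGroup N) \ hierBall k 0}) fun _ hv =>
      (localOn_adj (mk_mem_ballPairs.2 ⟨mem_hierBall.1 (hierBall_mono hkl _ hu),
        mem_hierBall.1 (Finset.mem_sdiff.1 hv).1⟩)).not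

theorem localOn_noCrossing_compl (k l : ℕ) :
    LocalOn (ballPairs k (0 : HierGroup N))ᶜ (NoCrossing c k l) := by
  refine LocalOn.forall_mem (S := {u | u ∈ hierBall k (0 : HierGroup N)}) fun u _ =>
    LocalOn.forall_mem (S := {v | v ∈ hierBall l (0 : HierGroup N) \ hierBall k 0}) fun v hv =>
      LocalOn.not (localOn_adj ?_)
  exact fun h => (Finset.mem_sdiff.1 hv).2 (mem_hierBall.2 (mk_mem_ballPairs.1 h).2)

/-- The absence of all crossing edges is a product of factors `1 - p`, each at least `exp (-(1 + η)
p)`. Hence only the expected number of crossing edges, bounded by `s`, matters. -/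
theorem prob_noCrossing_ge (hc0 : ∀ k, 1 ≤ k → 0 ≤ c k) {k l : ℕ} {η s : ℝ} (hη : 0 < η)
    (hsmall : ∀ j, k < j → c j / (N : ℝ) ^ (2 * j) ≤ η / (1 + η))
    (hs : ∑ i ∈ Finset.range (l - k), (1 - 1 / (N : ℝ)) * (1 / (N : ℝ) ^ (i + 1)) * c (k + 1 + i)
      ≤ s) :
    ENNReal.ofReal (Real.exp (-((1 + η) * s))) ≤ labelLaw N {U | NoCrossing c k l U} := by
  have hN0 : (0 : ℝ) < N := by exact_mod_cast Nat.pos_of_ne_zero (NeZero.ne N)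
  set T := hierBall l (0 : HierGroup N) \ hierBall k 0 with hT
  have hdist : ∀ u ∈ hierBall k (0 : HierGroup N), ∀ v ∈ T,
      k < hierDist u v ∧ hierDist u v ≤ l := by
    intro u hu v hv
    rw [hT, Finset.mem_sdiff] at hv
    have h1 := lt_hierDist_of_crossing le_rfl hu hv.2
    refine ⟨h1, ?_⟩
    have h2 := mem_hierBall.1 hu
    have h3 := mem_hierBall.1 hv.1
    rw [hierDist_eq_of_lt (x := 0) h2 (not_le.1 fun h => hv.2 (mem_hierBall.2 h))]
    exact h3
  have h := prob_forall_not_adj (N := N) (δ := 1) (c := c) (S := hierBall k 0) (T := T)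
    (Finset.disjoint_sdiff) fun u hu v hv => connProb_nonneg (hc0 _ (by
      have := (hdist u hu v hv).1
      omega))
  unfold NoCrossing
  rw [h]
  refine ENNReal.ofReal_le_ofReal ?_
  have h1 : ∀ u ∈ hierBall k (0 : HierGroup N), ∀ v ∈ T,
      Real.exp (-((1 + η) * (c (hierDist u v) / (N : ℝ) ^ (2 * hierDist u v)))) ≤
        1 - connProb N 1 c (hierDist u v) := by
    intro u hu v hv
    have hlt := (hdist u hu v hv).1
    have h2 := exp_neg_le_one_sub hη (connProb_nonneg (N := N) (δ := 1)
      (hc0 (hierDist u v) (by omega))) ((connProb_one_le _).trans (hsmall _ hlt))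
    refine le_trans (Real.exp_le_exp.2 ?_) h2
    have := connProb_one_le (N := N) (c := c) (hierDist u v)
    nlinarith
  refine le_trans ?_ (Finset.prod_le_prod (fun u _ => Finset.prod_nonneg fun v _ =>
    (Real.exp_pos _).le) fun u hu => Finset.prod_le_prod (fun v _ => (Real.exp_pos _).le) (h1 u hu))
  simp_rw [← Real.exp_sum]
  refine Real.exp_le_exp.2 ?_
  simp_rw [Finset.sum_neg_distrib, ← Finset.mul_sum]
  rw [neg_le_neg_iff]
  refine mul_le_mul_of_nonneg_left ?_ (by linarith)
  refine le_trans (Finset.sum_le_sum fun u hu => sum_hierDist_le u (hdist u hu)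
    (fun j => c j / (N : ℝ) ^ (2 * j)) fun j hj => div_nonneg (hc0 j (by omega)) (by positivity)) ?_
  rw [Finset.sum_const, card_hierBall, nsmul_eq_mul]
  refine le_trans (le_of_eq ?_) hs
  rw [← Finset.Ico_add_one_add_one_eq_Ioc, Finset.sum_Ico_eq_sum_range, Finset.mul_sum]
  rw [show l + 1 - (k + 1) = l - k by omega]
  refine Finset.sum_congr rfl fun i _ => ?_
  have e1 : (N : ℝ) ^ (k + 1 + i) = (N : ℝ) ^ k * (N : ℝ) ^ (i + 1) := by ring
  have e2 : (N : ℝ) ^ (k + 1 + i - 1) = (N : ℝ) ^ k * (N : ℝ) ^ i := by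
    rw [show k + 1 + i - 1 = k + i by omega, pow_add]
  rw [mul_comm 2, pow_mul, e1, e2]
  push_cast
  field_simp
  ring

/-- The expected number of crossing edges is at most `(C₁ / N) log k` plus a constant, uniformly in
`l`. Exponentiating gives a power of `k` with exponent `-β`, where `β = (1 + η) C₁ / N`, and `η` is
chosen to keep `β < 1`. -/
theorem exists_prob_noCrossing_ge (hN : 2 ≤ N) {C₀ C₁ α : ℝ} (h0 : 0 ≤ C₀) (h1 : 0 ≤ C₁)
    (h1N : C₁ < N) : ∃ a β : ℝ, 0 < a ∧ 0 ≤ β ∧ β < 1 ∧ ∃ k₀ : ℕ, 1 ≤ k₀ ∧ ∀ k l, k₀ ≤ k →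
      ENNReal.ofReal (a * (k : ℝ) ^ (-β)) ≤
        labelLaw N {U | NoCrossing (criticalRate C₀ C₁ 0 α) k l U} := by
  have hN0 : (0 : ℝ) < N := by positivity
  have hN2 : (2 : ℝ) ≤ N := by exact_mod_cast hN
  obtain ⟨η, hη, hβ⟩ : ∃ η : ℝ, 0 < η ∧ (1 + η) * (C₁ / N) < 1 := by
    have hq : C₁ / N < 1 := by rwa [div_lt_one hN0]
    have hq0 : 0 ≤ C₁ / N := by positivity
    refine ⟨(1 - C₁ / N) / 2, by linarith, ?_⟩
    nlinarith
  have hrate : ∀ k : ℕ, criticalRate C₀ C₁ 0 α k = C₀ + C₁ * Real.log k := by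
    intro k
    simp [criticalRate]
  have hs1 := summable_pow_div_pow (N := N) hN 1
  set W : ℝ := ∑' j : ℕ, (j : ℝ) ^ 1 / (N : ℝ) ^ j with hW
  have hlim : ∀ᶠ j : ℕ in Filter.atTop,
      criticalRate C₀ C₁ 0 α j / (N : ℝ) ^ (2 * j) ≤ η / (1 + η) := by
    have ht : Filter.Tendsto (fun j : ℕ => (C₀ + C₁) * ((j : ℝ) ^ 1 / (N : ℝ) ^ j))
        Filter.atTop (nhds 0) := by
      simpa using hs1.tendsto_atTop_zero.const_mul (C₀ + C₁)
    filter_upwards [ht.eventually_le_const (show 0 < η / (1 + η) by positivity),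
      Filter.eventually_ge_atTop 1] with j hj hj1
    refine le_trans ?_ hj
    have hj1' : (1 : ℝ) ≤ j := by exact_mod_cast hj1
    rw [hrate, ← mul_div_assoc]
    have e1 : Real.log j ≤ j := Real.log_le_self (by linarith)
    have e2 : (N : ℝ) ^ j ≤ (N : ℝ) ^ (2 * j) := pow_le_pow_right₀ (by linarith) (by omega)
    gcongr
    nlinarith
  obtain ⟨k₁, hk₁⟩ := Filter.eventually_atTop.1 hlim
  refine ⟨Real.exp (-((1 + η) * (C₀ / N + C₁ * W))), (1 + η) * (C₁ / N), Real.exp_pos _,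
    by positivity, hβ, max 1 k₁, le_max_left _ _, fun k l hk => ?_⟩
  have hk1 : (1 : ℝ) ≤ k := by exact_mod_cast (le_max_left _ _).trans hk
  have hS : ∑ i ∈ Finset.range (l - k), (1 - 1 / (N : ℝ)) * (1 / (N : ℝ) ^ (i + 1)) *
      criticalRate C₀ C₁ 0 α (k + 1 + i) ≤ (C₀ / N + C₁ * W) + C₁ / N * Real.log k := by
    have t1 : ∀ i ∈ Finset.range (l - k), (1 - 1 / (N : ℝ)) * (1 / (N : ℝ) ^ (i + 1)) *
        criticalRate C₀ C₁ 0 α (k + 1 + i) ≤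
        (1 - 1 / (N : ℝ)) * (1 / (N : ℝ) ^ (i + 1)) * (C₀ + C₁ * Real.log k) +
          C₁ * (((i + 1 : ℕ) : ℝ) ^ 1 / (N : ℝ) ^ (i + 1)) := by
      intro i _
      -- The excess `i + 1` over `log k` is absorbed by the geometric weights and contributes only a
      -- constant, `C₁ * W`.
      have hlog : Real.log ((k + 1 + i : ℕ) : ℝ) ≤ Real.log k + (i + 1) := by
        have hprod : ((k + 1 + i : ℕ) : ℝ) ≤ k * (1 + (i + 1)) := by
          push_cast
          nlinarith [(Nat.cast_nonneg i : (0 : ℝ) ≤ i)]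
        have hpos : (0 : ℝ) < 1 + ((i : ℝ) + 1) := by positivity
        refine (Real.log_le_log (by positivity) hprod).trans ?_
        rw [Real.log_mul (by linarith) hpos.ne']
        linarith [Real.log_le_sub_one_of_pos hpos]
      rw [hrate]
      have hf0 : 0 ≤ (1 - 1 / (N : ℝ)) := by
        rw [sub_nonneg, div_le_one hN0]
        linarith
      have hf1 : (1 - 1 / (N : ℝ)) ≤ 1 := by
        have : (0 : ℝ) ≤ 1 / N := by positivity
        linarith
      have hg : (0 : ℝ) ≤ 1 / (N : ℝ) ^ (i + 1) := by positivity
      have hw : C₀ + C₁ * Real.log ((k + 1 + i : ℕ) : ℝ) ≤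
          (C₀ + C₁ * Real.log k) + C₁ * (i + 1) := by nlinarith
      refine (mul_le_mul_of_nonneg_left hw (mul_nonneg hf0 hg)).trans ?_
      rw [mul_add]
      refine add_le_add le_rfl ?_
      have : (1 - 1 / (N : ℝ)) * (1 / (N : ℝ) ^ (i + 1)) * (C₁ * (i + 1)) ≤
          1 * (1 / (N : ℝ) ^ (i + 1)) * (C₁ * (i + 1)) := by gcongr
      refine this.trans (le_of_eq ?_)
      push_cast
      ring
    refine (Finset.sum_le_sum t1).trans ?_
    rw [Finset.sum_add_distrib, ← Finset.sum_mul, ← Finset.mul_sum (a := C₁)]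
    have hlogk : 0 ≤ Real.log k := Real.log_nonneg hk1
    have t2 := mul_le_mul_of_nonneg_right (sum_geometric_le hN (l - k))
      (show 0 ≤ C₀ + C₁ * Real.log k by positivity)
    have t3 : ∑ i ∈ Finset.range (l - k), (((i + 1 : ℕ) : ℝ) ^ 1 / (N : ℝ) ^ (i + 1)) ≤ W := by
      have hs' : Summable fun i : ℕ => (((i + 1 : ℕ) : ℝ) ^ 1 / (N : ℝ) ^ (i + 1)) :=
        (summable_nat_add_iff 1).2 hs1
      refine (hs'.sum_le_tsum _ fun i _ => by positivity).trans ?_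
      rw [hW, hs1.tsum_eq_zero_add]
      simp
    have t4 := mul_le_mul_of_nonneg_left t3 h1
    calc _ ≤ 1 / (N : ℝ) * (C₀ + C₁ * Real.log k) + C₁ * W := add_le_add t2 t4
      _ = _ := by ring
  have key := prob_noCrossing_ge (N := N) (c := criticalRate C₀ C₁ 0 α) (k := k) (l := l)
    (fun k _ => criticalRate_nonneg h0 h1 le_rfl k) hη
    (fun j hj => hk₁ j (by have := (le_max_right _ _).trans hk; omega)) hS
  refine le_trans (ENNReal.ofReal_le_ofReal (le_of_eq ?_)) key
  rw [Real.rpow_def_of_pos (by linarith), ← Real.exp_add]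
  congr 1
  ring

/-- The events before scale `M` are read off inside the ball of radius `K M`, while the event at
scale `M` uses only pairs not contained in it. Independence gives one factor `1 - q` per scale. -/
theorem prob_forall_crossing_le {K : ℕ → ℕ} (hK : Monotone K) {q : ℝ} (hq1 : q ≤ 1)
    {M : ℕ} (hq : ∀ j < M, ENNReal.ofReal q ≤ labelLaw N {U | NoCrossing c (K j) (K (j + 1)) U}) :
    labelLaw N {U | ∀ j < M, ¬ NoCrossing c (K j) (K (j + 1)) U} ≤
      ENNReal.ofReal ((1 - q) ^ M) := by
  have hloc : ∀ m, LocalOn (ballPairs (K m) (0 : HierGroup N))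
      fun U => ∀ j < m, ¬ NoCrossing c (K j) (K (j + 1)) U := by
    intro m
    refine LocalOn.forall_mem (S := {j | j < m}) fun j hj => LocalOn.not ?_
    exact (localOn_noCrossing_inside (hK (Nat.le_succ j))).mono
      (ballPairs_mono (hK (Nat.succ_le_of_lt hj)) (by simp [hierDist_self]))
  induction M with
  | zero => simp
  | succ M ih =>
    have h1 : {U : EdgeLabels N | ∀ j < M + 1, ¬ NoCrossing c (K j) (K (j + 1)) U} =
        {U | (∀ j < M, ¬ NoCrossing c (K j) (K (j + 1)) U) ∧
          ¬ NoCrossing c (K M) (K (M + 1)) U} := by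
      ext U
      exact Nat.forall_lt_succ_right
    rw [h1, prob_and_of_disjoint (hloc M) (localOn_noCrossing_compl (K M) (K (M + 1))).not
      disjoint_compl_right, pow_succ, ENNReal.ofReal_mul (pow_nonneg (by linarith) _)]
    refine mul_le_mul' (ih fun j hj => hq j (by omega)) ?_
    have h2 := prob_compl_eq_one_sub (μ := labelLaw N)
      (localOn_noCrossing_compl (c := c) (N := N) (K M) (K (M + 1))).measurableSet
    change labelLaw N {U | NoCrossing c (K M) (K (M + 1)) U}ᶜ ≤ _
    rw [h2]
    have h3 := hq M (by omega)
    by_cases hq0 : 0 ≤ q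
    · rw [ENNReal.ofReal_sub _ hq0, ENNReal.ofReal_one]
      gcongr
    · refine tsub_le_self.trans ?_
      rw [ENNReal.one_le_ofReal]
      linarith

theorem not_percolates_of_log (hN : 2 ≤ N) {C₀ C₁ α : ℝ} (h0 : 0 ≤ C₀) (h1 : 0 ≤ C₁)
    (h1N : C₁ < N) : ¬ Percolates N 1 (criticalRate C₀ C₁ 0 α) := by
  obtain ⟨a, β, ha, hβ0, hβ1, k₀, hk₀, hnc⟩ :=
    exists_prob_noCrossing_ge (N := N) (α := α) hN h0 h1 h1N
  have hN0 : (0 : ℝ) < N := by positivity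
  set c := criticalRate C₀ C₁ 0 α with hcdef
  have hc0 : ∀ k, 1 ≤ k → 0 ≤ c k := fun k _ => criticalRate_nonneg h0 h1 le_rfl k
  have hcA : ∀ k, 1 ≤ k → c k ≤ (C₀ + C₁) * (k : ℝ) ^ 1 := by
    intro k hk
    have hk' : (1 : ℝ) ≤ k := by exact_mod_cast hk
    have e1 : Real.log k ≤ k := Real.log_le_self (by linarith)
    simp only [hcdef, criticalRate, zero_mul, add_zero, pow_one]
    nlinarith
  set W : ℝ := ∑' j : ℕ, (j : ℝ) ^ 1 / (N : ℝ) ^ j with hW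
  have hW0 : 0 ≤ W := tsum_nonneg fun j => by positivity
  -- This choice gives `p - (p + 1) β ≥ 1`, so `t ^ p` trials of success probability at least `b
  -- t^{-(p+1)β}` have at least `b t` expected successes.
  obtain ⟨p, hp⟩ := exists_nat_ge ((1 + β) / (1 - β))
  rw [div_le_iff₀ (by linarith)] at hp
  set b : ℝ := min (a * (2 : ℝ) ^ (-β)) 1 with hb
  have hb0 : 0 < b := by positivity
  -- the estimate at a fixed scale
  have hmain : ∀ t : ℕ, k₀ ≤ t → labelLaw N
      {U | ((hierGraph N 1 c U).connectedComponentMk (0 : HierGroup N)).supp.Infinite} ≤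
      ENNReal.ofReal (Real.exp (-(b * t)) +
        3 * ((C₀ + C₁) * W) * ((t : ℝ) ^ (2 * p + 1) / (N : ℝ) ^ t)) := by
    intro t ht
    have ht1 : (1 : ℝ) ≤ t := by exact_mod_cast hk₀.trans ht
    set M := t ^ p with hM
    have hM1 : 1 ≤ M := Nat.one_le_pow _ _ (by omega)
    -- The radii run through multiples of `t` from `t^(p+1)` to `2 t^(p+1)`: their order of
    -- magnitude is fixed, and the gap `t` makes jumps over a scale exponentially rare.
    set K : ℕ → ℕ := fun j => (M + j) * t with hK
    have hKmono : Monotone K := fun i j hij => Nat.mul_le_mul_right _ (by omega)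
    have hKle : ∀ j ≤ M, K j ≤ 2 * t ^ (p + 1) := by
      intro j hj
      calc K j ≤ (M + M) * t := Nat.mul_le_mul_right _ (by omega)
        _ = 2 * t ^ (p + 1) := by rw [hM]; ring
    set q : ℝ := b * ((t : ℝ) ^ (p + 1)) ^ (-β) with hq
    have hq1 : q ≤ 1 := by
      refine mul_le_one₀ (min_le_right _ _) (by positivity) ?_
      exact Real.rpow_le_one_of_one_le_of_nonpos (one_le_pow₀ ht1) (by linarith)
    have hqle : ∀ j < M, ENNReal.ofReal q ≤ labelLaw N {U | NoCrossing c (K j) (K (j + 1)) U} := by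
      intro j hj
      have hKk : k₀ ≤ K j := ht.trans (Nat.le_mul_of_pos_left _ (by omega))
      refine le_trans (ENNReal.ofReal_le_ofReal ?_) (hnc _ _ hKk)
      have hle : ((K j : ℕ) : ℝ) ≤ 2 * (t : ℝ) ^ (p + 1) := by exact_mod_cast hKle j hj.le
      have hpos : (0 : ℝ) < (K j : ℕ) := by exact_mod_cast (by omega : 0 < K j)
      calc q ≤ a * (2 : ℝ) ^ (-β) * ((t : ℝ) ^ (p + 1)) ^ (-β) := by
            rw [hq]; gcongr; exact min_le_left _ _
        _ = a * (2 * (t : ℝ) ^ (p + 1)) ^ (-β) := by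
            rw [Real.mul_rpow (by norm_num) (by positivity)]; ring
        _ ≤ _ := by
            refine mul_le_mul_of_nonneg_left ?_ ha.le
            exact Real.rpow_le_rpow_of_nonpos hpos hle (by linarith)
    -- If some scale has neither a crossing edge nor an edge jumping beyond the next radius, no edge
    -- leaves the ball of radius `K j`, which then contains the cluster of `0`.
    have hsub : {U | ((hierGraph N 1 c U).connectedComponentMk (0 : HierGroup N)).supp.Infinite} ⊆
        {U | ∀ j < M, ¬ NoCrossing c (K j) (K (j + 1)) U} ∪
          ⋃ j ∈ Finset.range M, {U | ∃ u ∈ hierBall (K j) (0 : HierGroup N), ∃ v,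
            K (j + 1) < hierDist u v ∧ (hierGraph N 1 c U).Adj u v} := by
      intro U hU
      by_contra hcon
      simp only [Set.mem_union, Set.mem_iUnion, not_or, Set.mem_ofPred_eq, not_forall,
        not_exists, not_not, Finset.mem_range, exists_prop, not_and] at hcon
      obtain ⟨⟨j, hj, hno⟩, hlong⟩ := hcon
      refine hU ((hierBall (K j) (0 : HierGroup N)).finite_toSet.subset
        (SimpleGraph.supp_subset_of_forall_adj (self_mem_hierBall _ _) ?_))
      intro u hu v hadj
      by_contra hv
      rw [Finset.mem_coe] at hu hv
      by_cases hv' : v ∈ hierBall (K (j + 1)) (0 : HierGroup N)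
      · exact hno u hu v (Finset.mem_sdiff.2 ⟨hv', hv⟩) hadj
      · exact hlong j hj u hu v
          (lt_hierDist_of_crossing (hKmono (Nat.le_succ j)) hu hv') hadj
    refine (measure_mono hsub).trans ((measure_union_le _ _).trans ?_)
    rw [ENNReal.ofReal_add (by positivity) (by positivity)]
    refine add_le_add ?_ ?_
    · refine (prob_forall_crossing_le hKmono hq1 hqle).trans (ENNReal.ofReal_le_ofReal ?_)
      calc (1 - q) ^ M ≤ (Real.exp (-q)) ^ M := by
            refine pow_le_pow_left₀ (by linarith) ?_ _
            linarith [Real.add_one_le_exp (-q)]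
        _ = Real.exp (-(q * M)) := by rw [← Real.exp_nat_mul]; ring_nf
        _ ≤ Real.exp (-(b * t)) := by
            refine Real.exp_le_exp.2 (neg_le_neg ?_)
            rw [hq, hM, mul_assoc]
            refine mul_le_mul_of_nonneg_left ?_ hb0.le
            push_cast
            rw [← Real.rpow_natCast, ← Real.rpow_natCast, ← Real.rpow_mul (by positivity),
              ← Real.rpow_add (by positivity)]
            conv_lhs => rw [← Real.rpow_one (t : ℝ)]
            refine Real.rpow_le_rpow_of_exponent_le ht1 ?_
            push_cast
            linarith
    · refine (measure_biUnion_finset_le _ _).trans ?_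
      have hterm : ∀ j ∈ Finset.range M, labelLaw N {U | ∃ u ∈ hierBall (K j) (0 : HierGroup N),
          ∃ v, K (j + 1) < hierDist u v ∧ (hierGraph N 1 c U).Adj u v} ≤
          ENNReal.ofReal (3 * ((C₀ + C₁) * W) * ((t : ℝ) ^ (p + 1) / (N : ℝ) ^ t)) := by
        intro j hj
        rw [Finset.mem_range] at hj
        refine (prob_long_edge_le hN hc0 (by positivity) hcA 0 _ _).trans
          (ENNReal.ofReal_le_ofReal ?_)
        rw [← hW]
        have hle : ((K (j + 1) : ℕ) : ℝ) ≤ 2 * (t : ℝ) ^ (p + 1) := by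
          exact_mod_cast hKle (j + 1) (by omega)
        have hone : (1 : ℝ) ≤ (t : ℝ) ^ (p + 1) := one_le_pow₀ ht1
        have hdiv : (N : ℝ) ^ K j / (N : ℝ) ^ K (j + 1) = 1 / (N : ℝ) ^ t := by
          have : K (j + 1) = K j + t := by simp only [hK]; ring
          rw [this, pow_add]
          field_simp
        rw [hdiv, pow_one]
        calc (C₀ + C₁) * W * ((K (j + 1) : ℕ) + 1) * (1 / (N : ℝ) ^ t)
            ≤ (C₀ + C₁) * W * (3 * (t : ℝ) ^ (p + 1)) * (1 / (N : ℝ) ^ t) := by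
              gcongr
              linarith
          _ = _ := by ring
      refine (Finset.sum_le_sum hterm).trans (le_of_eq ?_)
      rw [Finset.sum_const, Finset.card_range, nsmul_eq_mul, ← ENNReal.ofReal_natCast,
        ← ENNReal.ofReal_mul (by positivity)]
      congr 1
      rw [hM]
      push_cast
      ring
  unfold Percolates
  rw [not_lt]
  have hlim : Filter.Tendsto (fun t : ℕ => ENNReal.ofReal (Real.exp (-(b * t)) +
      3 * ((C₀ + C₁) * W) * ((t : ℝ) ^ (2 * p + 1) / (N : ℝ) ^ t))) Filter.atTop (nhds 0) := by
    rw [← ENNReal.ofReal_zero]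
    refine ENNReal.tendsto_ofReal ?_
    rw [show (0 : ℝ) = 0 + 3 * ((C₀ + C₁) * W) * 0 by ring]
    refine Filter.Tendsto.add ?_ ?_
    · refine Real.tendsto_exp_neg_atTop_nhds_zero.comp ?_
      exact tendsto_natCast_atTop_atTop.const_mul_atTop hb0
    · exact (summable_pow_div_pow hN _).tendsto_atTop_zero.const_mul _
  exact ge_of_tendsto hlim (Filter.eventually_atTop.2 ⟨k₀, hmain⟩)

end Logarithmic

theorem LocalOn.iff {N : ℕ} {E : Set (Sym2 (HierGroup N))} {P Q : EdgeLabels N → Prop}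
    (hP : LocalOn E P) (hQ : LocalOn E Q) : LocalOn E fun U => (P U ↔ Q U) := by
  simpa only [iff_iff_implies_and_implies] using (hP.imp hQ).and (hQ.imp hP)

/-! ### Renormalisation: good balls and their cores -/

section Core

variable {N : ℕ}

/-- The ball of radius `k (n + 1)` around `y` is good with respect to `T`: all but at most one of
its sub-balls of radius `k n` meet `T`, and the traces of `T` on any two sub-balls that meet `T`
are joined by an edge. -/
def GoodAt (c : ℕ → ℝ) (k : ℕ → ℕ) (n : ℕ) (T : Set (HierGroup N)) (U : EdgeLabels N)
    (y : HierGroup N) : Prop :=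
  (∃ z, ∀ w, (hierDist y w ≤ k (n + 1) ∧ k n < hierDist z w) → ∃ v, hierDist w v ≤ k n ∧ v ∈ T) ∧
  ∀ u, hierDist y u ≤ k (n + 1) → ∀ v, (hierDist y v ≤ k (n + 1) ∧ k n < hierDist u v) →
    u ∈ T → v ∈ T → ∃ u', hierDist u u' ≤ k n ∧ ∃ v', hierDist v v' ≤ k n ∧
      u' ∈ T ∧ v' ∈ T ∧ (hierGraph N 1 c U).Adj u' v'

/-- The points whose surrounding balls are good at all scales below `n`. -/
def core (c : ℕ → ℝ) (k : ℕ → ℕ) (U : EdgeLabels N) : ℕ → Set (HierGroup N)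
  | 0 => Set.univ
  | n + 1 => {y | y ∈ core c k U n ∧ GoodAt c k n (core c k U n) U y}

variable {c : ℕ → ℝ} {k : ℕ → ℕ}

/-- Every point of an ultrametric ball is a centre, so goodness belongs to the ball and not to the
point chosen in it. -/
theorem GoodAt.congr {n : ℕ} {T : Set (HierGroup N)} {U : EdgeLabels N} {y y' : HierGroup N}
    (h : GoodAt c k n T U y) (hy : hierDist y y' ≤ k (n + 1)) : GoodAt c k n T U y' := by
  obtain ⟨⟨z, hz⟩, h2⟩ := h
  refine ⟨⟨z, fun w hw => hz w ⟨hierDist_trans_le hy hw.1, hw.2⟩⟩, fun u hu v hv => ?_⟩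
  exact h2 u (hierDist_trans_le hy hu) v ⟨hierDist_trans_le hy hv.1, hv.2⟩

theorem localOn_goodAt (hk : Monotone k) {n : ℕ} {T : EdgeLabels N → Set (HierGroup N)}
    (hT : ∀ y, LocalOn (ballPairs (k n) y) fun U => y ∈ T U) (y : HierGroup N) :
    LocalOn (ballPairs (k (n + 1)) y) fun U => GoodAt c k n (T U) U y := by
  have hkn : k n ≤ k (n + 1) := hk (Nat.le_succ n)
  have hT' : ∀ v, hierDist y v ≤ k (n + 1) →
      LocalOn (ballPairs (k (n + 1)) y) fun U => v ∈ T U :=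
    fun v hv => (hT v).mono (ballPairs_mono hkn hv)
  refine LocalOn.and (LocalOn.exists fun z => LocalOn.forall_mem
    (S := {w | hierDist y w ≤ k (n + 1) ∧ k n < hierDist z w}) fun w hw =>
      LocalOn.exists_mem (S := {v | hierDist w v ≤ k n}) fun v hv =>
        hT' v (hierDist_trans_le hw.1 (le_trans hv hkn))) ?_
  refine LocalOn.forall_mem (S := {u | hierDist y u ≤ k (n + 1)}) fun u hu =>
    LocalOn.forall_mem (S := {v | hierDist y v ≤ k (n + 1) ∧ k n < hierDist u v}) fun v hv =>
      (hT' u hu).imp ((hT' v hv.1).imp (LocalOn.exists_mem (S := {u' | hierDist u u' ≤ k n})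
        fun u' hu' => LocalOn.exists_mem (S := {v' | hierDist v v' ≤ k n}) fun v' hv' => ?_))
  have hu2 : hierDist y u' ≤ k (n + 1) := hierDist_trans_le hu (le_trans hu' hkn)
  have hv2 : hierDist y v' ≤ k (n + 1) := hierDist_trans_le hv.1 (le_trans hv' hkn)
  exact (hT' u' hu2).and ((hT' v' hv2).and (localOn_adj (mk_mem_ballPairs.2 ⟨hu2, hv2⟩)))

theorem localOn_mem_core (hk : Monotone k) (n : ℕ) (y : HierGroup N) :
    LocalOn (ballPairs (k n) y) fun U => y ∈ core c k U n := by
  induction n generalizing y with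
  | zero => exact LocalOn.const True
  | succ n ih =>
    exact ((ih y).mono (ballPairs_mono (hk (Nat.le_succ n)) (by simp [hierDist_self]))).and
      (localOn_goodAt hk ih y)

/-- By induction on the scale: within a sub-ball the core is already connected, and goodness
supplies an edge between the cores of two sub-balls. At scale `0` all pairs are joined with
certainty. -/
theorem reachable_of_mem_core {U : EdgeLabels N}
    (hbase : ∀ j, 1 ≤ j → j ≤ k 0 → connProb N 1 c j = 1) {n : ℕ} {u v : HierGroup N}
    (hu : u ∈ core c k U n) (hv : v ∈ core c k U n) (huv : hierDist u v ≤ k n) :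
    (hierGraph N 1 c U).Reachable u v := by
  induction n generalizing u v with
  | zero =>
    by_cases heq : u = v
    · rw [heq]
    · refine SimpleGraph.Adj.reachable ⟨heq, ?_⟩
      rw [hbase _ (Nat.one_le_iff_ne_zero.2 (mt hierDist_eq_zero.1 heq)) huv]
      exact (U s(u, v)).2.2
  | succ n ih =>
    by_cases hlt : hierDist u v ≤ k n
    · exact ih hu.1 hv.1 hlt
    · obtain ⟨u', hu', v', hv', hu'T, hv'T, hadj⟩ :=
        hu.2.2 u (by simp [hierDist_self]) v ⟨huv, not_le.1 hlt⟩ hu.1 hv.1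
      refine (ih hu.1 hu'T hu').trans (hadj.reachable.trans ?_)
      exact (ih hv.1 hv'T hv').symm

variable [NeZero N]

open scoped Classical in
/-- The part of the core in the ball of radius `k n` around `y`. -/
noncomputable def coreBall (c : ℕ → ℝ) (k : ℕ → ℕ) (U : EdgeLabels N) (n : ℕ) (y : HierGroup N) :
    Finset (HierGroup N) :=
  (hierBall (k n) y).filter (· ∈ core c k U n)

theorem mem_coreBall {U : EdgeLabels N} {n : ℕ} {y v : HierGroup N} :
    v ∈ coreBall c k U n y ↔ hierDist y v ≤ k n ∧ v ∈ core c k U n := by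
  classical
  rw [coreBall, Finset.mem_filter, mem_hierBall]

theorem exists_rep_far (hN : 2 ≤ N) (hk : StrictMono k) (n : ℕ) (y z : HierGroup N) :
    ∃ w ∈ ballReps (k n) (k (n + 1)) y, k n < hierDist z w := by
  classical
  by_contra! h
  have h1 : (ballReps (k n) (k (n + 1)) y).card ≤ 1 := by
    rw [Finset.card_le_one]
    intro a ha b hb
    by_contra hab
    refine absurd (lt_hierDist_of_mem_ballReps ha hb hab) (not_lt.2 ?_)
    exact hierDist_trans_le (hierDist_comm z a ▸ h a ha) (h b hb)
  rw [card_ballReps] at h1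
  have h2 : 1 < N ^ (k (n + 1) - k n) :=
    Nat.one_lt_pow (by have := hk (Nat.lt_add_one n); omega) (by omega)
  omega

/-- There are at least two sub-balls and at most one is exceptional. Core points of another survive,
because goodness is shared by the whole ball. Hence a ball whose core is empty at the next scale is
not good. -/
theorem exists_mem_core_of_goodAt (hN : 2 ≤ N) (hk : StrictMono k) {U : EdgeLabels N} {n : ℕ}
    {y : HierGroup N} (h : GoodAt c k n (core c k U n) U y) :
    ∃ v, hierDist y v ≤ k (n + 1) ∧ v ∈ core c k U (n + 1) := by
  obtain ⟨z, hz⟩ := h.1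
  obtain ⟨w, hw, hzw⟩ := exists_rep_far hN hk n y z
  have hyw := (mem_ballReps.1 hw).1
  obtain ⟨v, hv, hvT⟩ := hz w ⟨hyw, hzw⟩
  have hyv := hierDist_trans_le hyw (hv.trans (hk.monotone (Nat.le_succ n)))
  exact ⟨v, hyv, hvT, h.congr hyv⟩

/-- A deterministic density bound: a ball with nonempty core is good, so it retains the cores of all
but at most one sub-ball. The hypothesis `hD` says that the density `D` pays for that lost sub-ball
at each scale. -/
theorem card_coreBall_ge (hN : 2 ≤ N) (hk : StrictMono k) {D : ℕ → ℝ} (hD0 : D 0 ≤ 1)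
    (hDn : ∀ n, 0 ≤ D n)
    (hD : ∀ n, D (n + 1) * (N : ℝ) ^ (k (n + 1) - k n) ≤ D n * ((N : ℝ) ^ (k (n + 1) - k n) - 1))
    {U : EdgeLabels N} {n : ℕ} {y : HierGroup N} (h : (coreBall c k U n y).Nonempty) :
    D n * (N : ℝ) ^ k n ≤ (coreBall c k U n y).card := by
  classical
  induction n generalizing y with
  | zero =>
    have h1 : coreBall c k U 0 y = hierBall (k 0) y := by
      ext v
      rw [mem_coreBall, mem_hierBall]
      exact and_iff_left trivial
    rw [h1, card_hierBall]
    push_cast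
    nlinarith [pow_pos (show (0 : ℝ) < N by positivity) (k 0)]
  | succ n ih =>
    obtain ⟨z₀, hz₀⟩ := h
    rw [mem_coreBall] at hz₀
    have hkn : k n ≤ k (n + 1) := hk.monotone (Nat.le_succ n)
    have hgood : GoodAt c k n (core c k U n) U y := hz₀.2.2.congr (by rw [hierDist_comm]; exact hz₀.1)
    obtain ⟨z, hz⟩ := hgood.1
    set R := ballReps (k n) (k (n + 1)) y with hR
    set R' := R.filter (fun w => k n < hierDist z w) with hR'
    -- Distinct representatives are more than `k n` apart, so at most one is within `k n` of `z`.
    have hcard : R.card ≤ R'.card + 1 := by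
      have h1 : (R.filter (fun w => ¬ k n < hierDist z w)).card ≤ 1 := by
        rw [Finset.card_le_one]
        intro a ha b hb
        rw [Finset.mem_filter, not_lt] at ha hb
        by_contra hab
        refine absurd (lt_hierDist_of_mem_ballReps ha.1 hb.1 hab) (not_lt.2 ?_)
        exact hierDist_trans_le (hierDist_comm z a ▸ ha.2) hb.2
      have h2 : R'.card + (R.filter (fun w => ¬ k n < hierDist z w)).card = R.card :=
        Finset.card_filter_add_card_filter_not (s := R) (fun w => k n < hierDist z w)
      omega
    have hsub : R'.biUnion (coreBall c k U n) ⊆ coreBall c k U (n + 1) y := by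
      intro v hv
      obtain ⟨w, hw, hvw⟩ := Finset.mem_biUnion.1 hv
      rw [mem_coreBall] at hvw ⊢
      have hyv := hierDist_trans_le (mem_ballReps.1 (Finset.mem_filter.1 hw).1).1 (hvw.1.trans hkn)
      exact ⟨hyv, hvw.2, hgood.congr hyv⟩
    have hdisj : (R' : Set (HierGroup N)).PairwiseDisjoint (coreBall c k U n) := by
      intro a ha b hb hab
      rw [Function.onFun, Finset.disjoint_left]
      intro v hva hvb
      rw [mem_coreBall] at hva hvb
      refine absurd (lt_hierDist_of_mem_ballReps (Finset.mem_filter.1 ha).1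
        (Finset.mem_filter.1 hb).1 hab) (not_lt.2 ?_)
      exact hierDist_trans_le hva.1 (hierDist_comm b v ▸ hvb.1)
    have hlow : ∀ w ∈ R', D n * (N : ℝ) ^ k n ≤ ((coreBall c k U n w).card : ℝ) := by
      intro w hw
      rw [hR', Finset.mem_filter] at hw
      obtain ⟨v, hv⟩ := hz w ⟨(mem_ballReps.1 hw.1).1, hw.2⟩
      exact ih ⟨v, mem_coreBall.2 hv⟩
    have hMR : (R.card : ℝ) = (N : ℝ) ^ (k (n + 1) - k n) := by
      rw [hR, card_ballReps]
      push_cast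
      rfl
    have hcard' : (N : ℝ) ^ (k (n + 1) - k n) - 1 ≤ (R'.card : ℝ) := by
      rw [← hMR, sub_le_iff_le_add]
      exact_mod_cast hcard
    calc D (n + 1) * (N : ℝ) ^ k (n + 1)
        = D (n + 1) * (N : ℝ) ^ (k (n + 1) - k n) * (N : ℝ) ^ k n := by
          rw [mul_assoc, ← pow_add, Nat.sub_add_cancel hkn]
      _ ≤ D n * ((N : ℝ) ^ (k (n + 1) - k n) - 1) * (N : ℝ) ^ k n :=
          mul_le_mul_of_nonneg_right (hD n) (by positivity)
      _ = ((N : ℝ) ^ (k (n + 1) - k n) - 1) * (D n * (N : ℝ) ^ k n) := by ring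
      _ ≤ R'.card * (D n * (N : ℝ) ^ k n) := by
          refine mul_le_mul_of_nonneg_right hcard' ?_
          exact mul_nonneg (hDn n) (by positivity)
      _ = ∑ _w ∈ R', D n * (N : ℝ) ^ k n := by simp
      _ ≤ ∑ w ∈ R', ((coreBall c k U n w).card : ℝ) := Finset.sum_le_sum hlow
      _ = ((R'.biUnion (coreBall c k U n)).card : ℝ) := by
          rw [Finset.card_biUnion hdisj]
          push_cast
          rfl
      _ ≤ _ := by exact_mod_cast Finset.card_le_card hsub

/-- Condition on the traces of the core in the two balls. They are determined by labels inside the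
balls, whereas the connecting edges use labels between them, and every connecting pair is at the
same distance. At least `s ^ 2` independent chances remain. -/
theorem prob_core_not_joined_le (hk : Monotone k) (hc0 : ∀ k, 1 ≤ k → 0 ≤ c k) {n : ℕ} {s e : ℝ}
    (hs0 : 0 ≤ s)
    (hs : ∀ (U : EdgeLabels N) y, (coreBall c k U n y).Nonempty → s ≤ (coreBall c k U n y).card)
    {w w' : HierGroup N} (hww' : k n < hierDist w w')
    (he : Real.exp (-(s ^ 2 * (c (hierDist w w') / (N : ℝ) ^ (2 * hierDist w w')))) ≤ e) :
    labelLaw N {U | (coreBall c k U n w).Nonempty ∧ (coreBall c k U n w').Nonempty ∧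
      ∀ u ∈ coreBall c k U n w, ∀ v ∈ coreBall c k U n w', ¬ (hierGraph N 1 c U).Adj u v} ≤
      ENNReal.ofReal e := by
  classical
  set j := hierDist w w' with hj
  have hdist : ∀ u v, hierDist w u ≤ k n → hierDist w' v ≤ k n → hierDist u v = j := by
    intro u v hu hv
    have h1 : hierDist w v = j := by
      have h := hierDist_eq_of_lt (x := w') (y := v) (z := w) hv (by rwa [hierDist_comm])
      rw [hierDist_comm w v, h, hierDist_comm]
    rw [hierDist_eq_of_lt hu (h1 ▸ hww'), h1]
  -- The event that the two traces are exactly the prescribed finite sets; for different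
  -- prescriptions these events exclude each other.
  let A : Finset (HierGroup N) × Finset (HierGroup N) → EdgeLabels N → Prop := fun i U =>
    (i.1.Nonempty ∧ i.2.Nonempty) ∧ (∀ v, v ∈ i.1 ↔ hierDist w v ≤ k n ∧ v ∈ core c k U n) ∧
      ∀ v, v ∈ i.2 ↔ hierDist w' v ≤ k n ∧ v ∈ core c k U n
  let B : Finset (HierGroup N) × Finset (HierGroup N) → EdgeLabels N → Prop := fun i U =>
    ∀ u, (u ∈ i.1 ∧ hierDist w u ≤ k n) → ∀ v, (v ∈ i.2 ∧ hierDist w' v ≤ k n) →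
      ¬ (hierGraph N 1 c U).Adj u v
  have hloc : ∀ x : HierGroup N, ∀ S : Finset (HierGroup N), LocalOn (ballPairs (k n) x)
      fun U => ∀ v, v ∈ S ↔ hierDist x v ≤ k n ∧ v ∈ core c k U n := by
    intro x S
    refine LocalOn.forall fun v => (LocalOn.const _).iff ?_
    by_cases hv : hierDist x v ≤ k n
    · simp only [hv, true_and]
      exact (localOn_mem_core hk n v).mono (ballPairs_mono le_rfl hv)
    · simpa only [hv, false_and] using LocalOn.const False
  have hA : ∀ i, LocalOn (ballPairs (k n) w ∪ ballPairs (k n) w') (A i) := fun i =>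
    (LocalOn.const _).and (((hloc w i.1).mono Set.subset_union_left).and
      ((hloc w' i.2).mono Set.subset_union_right))
  have hB : ∀ i, LocalOn {e | ∃ u v, hierDist w u ≤ k n ∧ hierDist w' v ≤ k n ∧ e = s(u, v)}
      (B i) := fun i =>
    LocalOn.forall_mem (S := {u | u ∈ i.1 ∧ hierDist w u ≤ k n}) fun u hu =>
      LocalOn.forall_mem (S := {v | v ∈ i.2 ∧ hierDist w' v ≤ k n}) fun v hv =>
        LocalOn.not (localOn_adj ⟨u, v, hu.2, hv.2, rfl⟩)
  have hd : Disjoint (ballPairs (k n) w ∪ ballPairs (k n) w')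
      {e | ∃ u v, hierDist w u ≤ k n ∧ hierDist w' v ≤ k n ∧ e = s(u, v)} := by
    rw [Set.disjoint_left]
    rintro _ h ⟨u, v, hu, hv, rfl⟩
    have h1 := hdist u v hu hv
    have h2 : hierDist u v ≤ k n := by
      rcases h with h | h
      · rw [mk_mem_ballPairs] at h
        exact hierDist_trans_le (hierDist_comm w u ▸ h.1) h.2
      · rw [mk_mem_ballPairs] at h
        exact hierDist_trans_le (hierDist_comm w' u ▸ h.1) h.2
    omega
  have hex : ∀ i i' U, A i U → A i' U → i = i' := by
    rintro i i' U ⟨-, h1, h2⟩ ⟨-, h1', h2'⟩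
    refine Prod.ext (Finset.ext fun v => ?_) (Finset.ext fun v => ?_)
    · rw [h1, h1']
    · rw [h2, h2']
  have hε : ∀ i, (∃ U, A i U) → labelLaw N {U | B i U} ≤ ENNReal.ofReal e := by
    rintro ⟨S, S'⟩ ⟨U, ⟨hS, hS'⟩, h1, h2⟩
    have e1 : S = coreBall c k U n w := by
      ext v
      rw [mem_coreBall]
      exact h1 v
    have e2 : S' = coreBall c k U n w' := by
      ext v
      rw [mem_coreBall]
      exact h2 v
    have hcS : s ≤ S.card := by rw [e1]; exact hs U w (e1 ▸ hS)
    have hcS' : s ≤ S'.card := by rw [e2]; exact hs U w' (e2 ▸ hS')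
    have hSd : ∀ u ∈ S, ∀ v ∈ S', hierDist u v = j := fun u hu v hv =>
      hdist u v ((h1 u).1 hu).1 ((h2 v).1 hv).1
    have hBset : {V | B (S, S') V} = {V | ∀ u ∈ S, ∀ v ∈ S', ¬ (hierGraph N 1 c V).Adj u v} := by
      ext V
      exact ⟨fun h u hu v hv => h u ⟨hu, ((h1 u).1 hu).1⟩ v ⟨hv, ((h2 v).1 hv).1⟩,
        fun h u hu v hv => h u hu.1 v hv.1⟩
    rw [hBset, prob_forall_not_adj]
    · refine ENNReal.ofReal_le_ofReal (le_trans ?_ he)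
      have hp : ∏ u ∈ S, ∏ v ∈ S', (1 - connProb N 1 c (hierDist u v)) =
          (1 - connProb N 1 c j) ^ (S'.card * S.card) := by
        rw [Finset.prod_congr rfl fun u hu => Finset.prod_congr rfl fun v hv => by
          rw [hSd u hu v hv]]
        simp [pow_mul]
      have hcj : 0 ≤ c j / (N : ℝ) ^ (2 * j) := div_nonneg (hc0 j (by omega)) (by positivity)
      have hexp := one_sub_connProb_le (N := N) (δ := 1) (c := c) (k := j)
      have hpow : (N : ℝ) ^ ((j : ℝ) * (1 + 1)) = (N : ℝ) ^ (2 * j) := by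
        rw [← Real.rpow_natCast]
        congr 1
        push_cast
        ring
      rw [hpow] at hexp
      rw [hp]
      calc (1 - connProb N 1 c j) ^ (S'.card * S.card)
          ≤ (Real.exp (-(c j / (N : ℝ) ^ (2 * j)))) ^ (S'.card * S.card) :=
            pow_le_pow_left₀ (sub_nonneg.2 (min_le_right _ _)) hexp _
        _ = Real.exp (-((S'.card * S.card : ℝ) * (c j / (N : ℝ) ^ (2 * j)))) := by
            rw [← Real.exp_nat_mul]
            push_cast
            ring_nf
        _ ≤ _ := by
            refine Real.exp_le_exp.2 (neg_le_neg ?_)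
            refine mul_le_mul_of_nonneg_right ?_ hcj
            rw [sq]
            exact mul_le_mul hcS' hcS hs0 (by positivity)
    · rw [Finset.disjoint_left]
      intro v hv hv'
      have := hSd v hv v hv'
      rw [hierDist_self] at this
      omega
    · intro u hu v hv
      rw [hSd u hu v hv]
      exact connProb_nonneg (hc0 j (by omega))
  refine le_trans (measure_mono ?_) ((prob_exists_and_le hA hB (fun _ => hd) hex hε).trans
    (mul_le_of_le_one_right' prob_le_one))
  rintro U ⟨hw, hw', hno⟩
  refine ⟨(coreBall c k U n w, coreBall c k U n w'), ⟨⟨hw, hw'⟩, fun v => mem_coreBall,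
    fun v => mem_coreBall⟩, fun u hu v hv => hno u hu.1 v hv.1⟩

/-- A ball that is not good contains a pair of sub-balls that either both have empty core
(probability at most `b ^ 2`, by independence) or both have a core but are not joined (at most `e`).
The prefactor bounds the number of pairs. -/
theorem prob_not_goodAt_le (hk : Monotone k) (hc0 : ∀ k, 1 ≤ k → 0 ≤ c k) {n : ℕ} {s e b : ℝ}
    (hs0 : 0 ≤ s) (hb0 : 0 ≤ b) (he0 : 0 ≤ e)
    (hs : ∀ (U : EdgeLabels N) y, (coreBall c k U n y).Nonempty → s ≤ (coreBall c k U n y).card)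
    (he : ∀ j, k n < j → j ≤ k (n + 1) →
      Real.exp (-(s ^ 2 * (c j / (N : ℝ) ^ (2 * j)))) ≤ e)
    (hb : ∀ y : HierGroup N, labelLaw N {U | ¬ ∃ v, hierDist y v ≤ k n ∧ v ∈ core c k U n} ≤
      ENNReal.ofReal b)
    (y : HierGroup N) :
    labelLaw N {U | ¬ GoodAt c k n (core c k U n) U y} ≤
      ENNReal.ofReal (((N : ℝ) ^ (k (n + 1) - k n)) ^ 2 * (b ^ 2 + e)) := by
  classical
  set R := ballReps (k n) (k (n + 1)) y with hR
  let P : HierGroup N → EdgeLabels N → Prop := fun w U =>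
    ∃ v, hierDist w v ≤ k n ∧ v ∈ core c k U n
  let B₁ : HierGroup N × HierGroup N → Set (EdgeLabels N) := fun p => {U | ¬ P p.1 U ∧ ¬ P p.2 U}
  let B₂ : HierGroup N × HierGroup N → Set (EdgeLabels N) := fun p =>
    {U | (coreBall c k U n p.1).Nonempty ∧ (coreBall c k U n p.2).Nonempty ∧
      ∀ u ∈ coreBall c k U n p.1, ∀ v ∈ coreBall c k U n p.2, ¬ (hierGraph N 1 c U).Adj u v}
  have hloc : ∀ w, LocalOn (ballPairs (k n) w) (P w) := fun w =>
    LocalOn.exists_mem (S := {v | hierDist w v ≤ k n}) fun v hv =>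
      (localOn_mem_core hk n v).mono (ballPairs_mono le_rfl hv)
  have hsub : {U | ¬ GoodAt c k n (core c k U n) U y} ⊆ ⋃ p ∈ R.offDiag, B₁ p ∪ B₂ p := by
    intro U hU
    by_contra hcon
    simp only [Set.mem_iUnion, not_exists, Set.mem_union, not_or, Prod.forall,
      Finset.mem_offDiag] at hcon
    apply hU
    refine ⟨?_, ?_⟩
    -- A representative with empty core marks the exceptional sub-ball; if there is none, any point
    -- serves as `z`.
    · by_cases hbad : ∃ z ∈ R, ¬ P z U
      · obtain ⟨z, hzR, hz⟩ := hbad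
        refine ⟨z, fun w hw => ?_⟩
        obtain ⟨w₀, hw₀, hw₀w⟩ := exists_mem_ballReps (k n) hw.1
        have hne : z ≠ w₀ := by
          rintro rfl
          omega
        by_contra hno
        refine (hcon z w₀ ⟨hzR, hw₀, hne⟩).1 ⟨hz, ?_⟩
        rintro ⟨v, hv, hvT⟩
        exact hno ⟨v, hierDist_trans_le (hierDist_comm w₀ w ▸ hw₀w) hv, hvT⟩
      · push Not at hbad
        refine ⟨y, fun w hw => ?_⟩
        obtain ⟨w₀, hw₀, hw₀w⟩ := exists_mem_ballReps (k n) hw.1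
        obtain ⟨v, hv, hvT⟩ := hbad w₀ hw₀
        exact ⟨v, hierDist_trans_le (hierDist_comm w₀ w ▸ hw₀w) hv, hvT⟩
    · intro u hu v hv huT hvT
      obtain ⟨u₀, hu₀, hu₀u⟩ := exists_mem_ballReps (k n) hu
      obtain ⟨v₀, hv₀, hv₀v⟩ := exists_mem_ballReps (k n) hv.1
      have hne : u₀ ≠ v₀ := by
        rintro rfl
        exact absurd (hierDist_trans_le (hierDist_comm u₀ u ▸ hu₀u) hv₀v) (not_le.2 hv.2)
      have h := (hcon u₀ v₀ ⟨hu₀, hv₀, hne⟩).2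
      by_contra hno
      refine h ⟨⟨u, mem_coreBall.2 ⟨hu₀u, huT⟩⟩, ⟨v, mem_coreBall.2 ⟨hv₀v, hvT⟩⟩, ?_⟩
      intro u' hu' v' hv' hadj
      rw [mem_coreBall] at hu' hv'
      exact hno ⟨u', hierDist_trans_le (hierDist_comm u₀ u ▸ hu₀u) hu'.1, v',
        hierDist_trans_le (hierDist_comm v₀ v ▸ hv₀v) hv'.1, hu'.2, hv'.2, hadj⟩
  have hpair : ∀ p ∈ R.offDiag, labelLaw N (B₁ p ∪ B₂ p) ≤ ENNReal.ofReal (b ^ 2 + e) := by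
    rintro ⟨w, w'⟩ hp
    rw [Finset.mem_offDiag] at hp
    have hlt := lt_hierDist_of_mem_ballReps hp.1 hp.2.1 hp.2.2
    have hle : hierDist w w' ≤ k (n + 1) :=
      hierDist_trans_le (hierDist_comm y w ▸ (mem_ballReps.1 hp.1).1) (mem_ballReps.1 hp.2.1).1
    refine (measure_union_le _ _).trans ?_
    rw [ENNReal.ofReal_add (by positivity) he0]
    refine add_le_add ?_ (prob_core_not_joined_le hk hc0 hs0 hs hlt (he _ hlt hle))
    have h1 : labelLaw N {U | ¬ P w U ∧ ¬ P w' U} = _ := prob_and_of_disjoint (hloc w).not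
      (hloc w').not (disjoint_ballPairs (by simpa using hlt))
    change labelLaw N {U | ¬ P w U ∧ ¬ P w' U} ≤ _
    rw [h1, sq, ENNReal.ofReal_mul hb0]
    exact mul_le_mul' (hb w) (hb w')
  refine (measure_mono hsub).trans ((measure_biUnion_finset_le _ _).trans
    ((Finset.sum_le_sum hpair).trans ?_))
  rw [Finset.sum_const, nsmul_eq_mul, ← ENNReal.ofReal_natCast,
    ← ENNReal.ofReal_mul (by positivity)]
  refine ENNReal.ofReal_le_ofReal (mul_le_mul_of_nonneg_right ?_ (by positivity))
  have hcard : R.offDiag.card ≤ (N ^ (k (n + 1) - k n)) ^ 2 := by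
    rw [Finset.offDiag_card, hR, card_ballReps, sq]
    exact Nat.sub_le _ _
  exact_mod_cast hcard

end Core

/-! ### The core yields an infinite cluster -/

section Infinite

variable {N : ℕ} {c : ℕ → ℝ} {k : ℕ → ℕ} {U : EdgeLabels N}

theorem mem_core_of_forall_goodAt {y : HierGroup N} {m n : ℕ} (hmn : m ≤ n)
    (hm : y ∈ core c k U m) (h : ∀ i, m ≤ i → i < n → GoodAt c k i (core c k U i) U y) :
    y ∈ core c k U n := by
  induction n, hmn using Nat.le_induction with
  | base => exact hm
  | succ n hmn ih =>
    exact ⟨ih fun i hi hi' => h i hi (by omega), h n hmn (by omega)⟩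

theorem prob_exists_not_goodAt_le {g : ℕ → ENNReal}
    (hg : ∀ n (y : HierGroup N), labelLaw N {U | ¬ GoodAt c k n (core c k U n) U y} ≤ g n)
    (y : HierGroup N) :
    labelLaw N {U | ¬ ∀ n, GoodAt c k n (core c k U n) U y} ≤ ∑' n, g n := by
  have h : {U | ¬ ∀ n, GoodAt c k n (core c k U n) U y} =
      ⋃ n, {U | ¬ GoodAt c k n (core c k U n) U y} := by
    ext; simp
  rw [h]
  exact (measure_iUnion_le _).trans (ENNReal.tsum_le_tsum fun n => hg n y)

theorem prob_notMem_core_le {g : ℕ → ENNReal}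
    (hg : ∀ n (y : HierGroup N), labelLaw N {U | ¬ GoodAt c k n (core c k U n) U y} ≤ g n)
    (y : HierGroup N) (m : ℕ) : labelLaw N {U | y ∉ core c k U m} ≤ ∑' n, g n := by
  refine (measure_mono fun U hU => ?_).trans (prob_exists_not_goodAt_le hg y)
  intro h
  exact hU (mem_core_of_forall_goodAt (Nat.zero_le m) trivial fun i _ _ => h i)

variable [NeZero N]

theorem infinite_supp_of_mem_core (hN : 2 ≤ N) (hk : StrictMono k)
    (hbase : ∀ j, 1 ≤ j → j ≤ k 0 → connProb N 1 c j = 1)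
    (hcard : ∀ n y, (coreBall c k U n y).Nonempty →
      (1 / 2 : ℝ) * (N : ℝ) ^ k n ≤ (coreBall c k U n y).card)
    {y : HierGroup N} {m : ℕ} (hy : ∀ n, m ≤ n → y ∈ core c k U n) :
    ((hierGraph N 1 c U).connectedComponentMk y).supp.Infinite := by
  intro hfin
  -- At this scale half of `N ^ k n` exceeds the size of the supposedly finite cluster, since `N ^ k
  -- n > n`.
  set n := m + 2 * (hfin.toFinset.card + 1) with hn
  have hyn : y ∈ coreBall c k U n y :=
    mem_coreBall.2 ⟨by simp [hierDist_self], hy n (by omega)⟩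
  have h1 := hcard n y ⟨y, hyn⟩
  have h2 : coreBall c k U n y ⊆ hfin.toFinset := by
    intro v hv
    rw [mem_coreBall] at hv
    rw [Set.Finite.mem_toFinset, SimpleGraph.ConnectedComponent.mem_supp_iff,
      SimpleGraph.ConnectedComponent.eq]
    exact (reachable_of_mem_core hbase (hy n (by omega)) hv.2 hv.1).symm
  have h3 := Finset.card_le_card h2
  have h4 : n < N ^ k n :=
    (Nat.lt_pow_self (by omega)).trans_le (Nat.pow_le_pow_right (by omega) (hk.le_apply))
  have h5 : (n : ℝ) < (N : ℝ) ^ k n := by exact_mod_cast h4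
  have h6 : ((coreBall c k U n y).card : ℝ) ≤ hfin.toFinset.card := by exact_mod_cast h3
  have h7 : (2 : ℝ) * (hfin.toFinset.card + 1) ≤ n := by
    rw [hn]
    push_cast
    have : (0 : ℝ) ≤ m := by positivity
    linarith
  linarith

/-- With probability at least `1/2` every ball around `0` is good; then `0` lies in the core at all
scales and its cluster is infinite. -/
theorem percolates_of_goodAt (hN : 2 ≤ N) (hk : StrictMono k)
    (hbase : ∀ j, 1 ≤ j → j ≤ k 0 → connProb N 1 c j = 1)
    (hcard : ∀ (U : EdgeLabels N) n y, (coreBall c k U n y).Nonempty →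
      (1 / 2 : ℝ) * (N : ℝ) ^ k n ≤ (coreBall c k U n y).card)
    {g : ℕ → ENNReal}
    (hg : ∀ n (y : HierGroup N), labelLaw N {U | ¬ GoodAt c k n (core c k U n) U y} ≤ g n)
    (hsum : ∑' n, g n ≤ 1 / 2) : Percolates N 1 c := by
  unfold Percolates
  have h1 := (prob_exists_not_goodAt_le hg (0 : HierGroup N)).trans hsum
  by_contra h0
  rw [not_lt, nonpos_iff_eq_zero] at h0
  have h2 : {U : EdgeLabels N | ∀ n, GoodAt c k n (core c k U n) U 0} ⊆
      {U | ((hierGraph N 1 c U).connectedComponentMk (0 : HierGroup N)).supp.Infinite} :=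
    fun U hU => infinite_supp_of_mem_core hN hk hbase (hcard U) (m := 0)
      fun n _ => mem_core_of_forall_goodAt (Nat.zero_le n) trivial fun i _ _ => hU i
  have h3 := measure_univ_le_add_compl (μ := labelLaw N)
    {U : EdgeLabels N | ∀ n, GoodAt c k n (core c k U n) U 0}
  rw [measure_mono_null h2 h0, zero_add, measure_univ] at h3
  have h4 : (1 : ENNReal) ≤ 1 / 2 := h3.trans h1
  rw [one_div, ENNReal.one_le_inv] at h4
  exact absurd h4 (by norm_num)

end Infinite

/-! ### Exploring a cluster from inside a ball -/

section Exploration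

variable {N : ℕ} {c : ℕ → ℝ} {k : ℕ → ℕ}

/-- `u` can be reached from `x` in `j` steps inside `B`. -/
def ReachWithin (c : ℕ → ℝ) (B : Set (HierGroup N)) (x : HierGroup N) (U : EdgeLabels N) :
    ℕ → HierGroup N → Prop
  | 0, u => x = u
  | j + 1, u => ∃ v, (v ∈ B ∧ u ∈ B) ∧ ReachWithin c B x U j v ∧ (hierGraph N 1 c U).Adj v u

theorem localOn_reachWithin (B : Set (HierGroup N)) (x : HierGroup N) (j : ℕ) (u : HierGroup N) :
    LocalOn (insidePairs B) fun U => ReachWithin c B x U j u := by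
  induction j generalizing u with
  | zero => exact LocalOn.const _
  | succ j ih =>
    exact LocalOn.exists_mem (S := {v | v ∈ B ∧ u ∈ B}) fun v hv =>
      (ih v).and (localOn_adj (mk_mem_insidePairs.2 hv))

theorem reachable_of_reachWithin {B : Set (HierGroup N)} {x : HierGroup N} {U : EdgeLabels N}
    {j : ℕ} {u : HierGroup N} (h : ReachWithin c B x U j u) :
    (hierGraph N 1 c U).Reachable x u := by
  induction j generalizing u with
  | zero =>
    obtain rfl : x = u := h
    rfl
  | succ j ih =>
    obtain ⟨v, -, hv, hadj⟩ := h
    exact (ih hv).trans hadj.reachable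

/-- `z ∉ B` is adjacent to a point of `B` that is connected to `x` inside `B`. -/
def IsExit (c : ℕ → ℝ) (B : Set (HierGroup N)) (x : HierGroup N) (U : EdgeLabels N)
    (z : HierGroup N) : Prop :=
  z ∉ B ∧ ∃ u, u ∈ B ∧ (∃ j, ReachWithin c B x U j u) ∧ (hierGraph N 1 c U).Adj u z

theorem localOn_isExit (B : Set (HierGroup N)) (x z : HierGroup N) :
    LocalOn (insidePairs B ∪ {e | ∃ u ∈ B, e = s(u, z)}) fun U => IsExit c B x U z := by
  refine (LocalOn.const _).and (LocalOn.exists_mem (S := B) fun u hu => ?_)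
  refine LocalOn.and (LocalOn.exists fun j => ?_) (localOn_adj (Or.inr ⟨u, hu, rfl⟩))
  exact (localOn_reachWithin B x j u).mono Set.subset_union_left

theorem IsExit.reachable {B : Set (HierGroup N)} {x z : HierGroup N} {U : EdgeLabels N}
    (h : IsExit c B x U z) : (hierGraph N 1 c U).Reachable x z := by
  obtain ⟨-, u, -, ⟨j, hj⟩, hadj⟩ := h
  exact (reachable_of_reachWithin hj).trans hadj.reachable

/-- Without an exit, the points reached inside the finite set `B` would be closed under adjacency
and contain the whole cluster. -/
theorem exists_isExit {B : Set (HierGroup N)} (hB : B.Finite) {x : HierGroup N} (hx : x ∈ B)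
    {U : EdgeLabels N} (hinf : ((hierGraph N 1 c U).connectedComponentMk x).supp.Infinite) :
    ∃ z, IsExit c B x U z := by
  by_contra! h
  refine hinf ((hB.subset fun u hu => hu.1).subset (SimpleGraph.supp_subset_of_forall_adj
    (S := {u | u ∈ B ∧ ∃ j, ReachWithin c B x U j u}) ⟨hx, 0, rfl⟩ ?_))
  rintro u ⟨hu, j, hj⟩ v hadj
  by_cases hv : v ∈ B
  · exact ⟨hv, j + 1, u, ⟨hu, hv⟩, hj, hadj⟩
  · exact absurd ⟨hv, u, hu, ⟨j, hj⟩, hadj⟩ (h v)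

/-- The ball of radius `k n` around `0`. -/
def originBall (N : ℕ) (k : ℕ → ℕ) (n : ℕ) : Set (HierGroup N) := {z | hierDist 0 z ≤ k n}

theorem originBall_mono (hk : Monotone k) {m n : ℕ} (h : m ≤ n) :
    originBall N k m ⊆ originBall N k n := fun _ hz => le_trans hz (hk h)

theorem finite_originBall [NeZero N] (n : ℕ) : (originBall N k n).Finite :=
  (hierBall (k n) (0 : HierGroup N)).finite_toSet.subset fun _ hz => mem_hierBall.2 hz

/-- `z` misses the core at the scale at which it lies: `z ∉ core m` if `z` is in the ball
of radius `k (m + 1)` but not in that of radius `k m`, where `m ≥ n`. -/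
def MissesCore (c : ℕ → ℝ) (k : ℕ → ℕ) (n : ℕ) (U : EdgeLabels N) (z : HierGroup N) : Prop :=
  ∀ m, (n ≤ m ∧ z ∉ originBall N k m ∧ z ∈ originBall N k (m + 1)) → z ∉ core c k U m

/-- The cluster of `x` in the ball of radius `k n` around `0` has a neighbour in the annulus up to
radius `k n'`, but all these neighbours miss the core. -/
def FailedExit (c : ℕ → ℝ) (k : ℕ → ℕ) (x : HierGroup N) (n n' : ℕ) (U : EdgeLabels N) : Prop :=
  (∃ z ∈ originBall N k n', IsExit c (originBall N k n) x U z) ∧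
    ∀ z ∈ originBall N k n', IsExit c (originBall N k n) x U z → MissesCore c k n U z

/-- A point first reached at scale `m + 1` with `m ≥ n` has its ball of radius `k m` disjoint from
the origin ball of radius `k n`. Its core status is thus independent of every label touching that
origin ball. -/
theorem localOn_missesCore (hk : Monotone k) (n : ℕ) (z : HierGroup N) :
    LocalOn (touchingPairs (originBall N k n))ᶜ fun U => MissesCore c k n U z := by
  refine LocalOn.forall_mem (S := {m | n ≤ m ∧ z ∉ originBall N k m ∧ z ∈ originBall N k (m + 1)})
    fun m hm => ((localOn_mem_core hk m z).mono ?_).not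
  rw [Set.subset_compl_iff_disjoint_left]
  refine disjoint_touchingPairs_insidePairs ((disjoint_balls (k := k m) ?_).mono_left
    (originBall_mono hk hm.1))
  simpa [originBall] using hm.2.1

theorem localOn_missesCore_inside (hk : Monotone k) (n n' : ℕ) {z : HierGroup N}
    (hz : z ∈ originBall N k n') :
    LocalOn (ballPairs (k n') 0) fun U => MissesCore c k n U z := by
  refine LocalOn.forall_mem (S := {m | n ≤ m ∧ z ∉ originBall N k m ∧ z ∈ originBall N k (m + 1)})
    fun m hm => ((localOn_mem_core hk m z).mono (ballPairs_mono (hk ?_) hz)).not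
  by_contra! hlt
  exact hm.2.1 (originBall_mono hk hlt.le hz)

theorem localOn_failedExit (hk : Monotone k) (x : HierGroup N) {n n' : ℕ} (hn : n ≤ n') :
    LocalOn (ballPairs (k n') 0) (FailedExit c k x n n') := by
  have hexit : ∀ z ∈ originBall N k n', LocalOn (ballPairs (k n') 0)
      fun U => IsExit c (originBall N k n) x U z := by
    intro z hz
    refine (localOn_isExit _ x z).mono (Set.union_subset ?_ ?_)
    · exact insidePairs_mono (originBall_mono hk hn)
    · rintro _ ⟨u, hu, rfl⟩
      exact mk_mem_ballPairs.2 ⟨originBall_mono hk hn hu, hz⟩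
  exact (LocalOn.exists_mem hexit).and (LocalOn.forall_mem fun z hz =>
    (hexit z hz).imp (localOn_missesCore_inside hk n n' hz))

theorem prob_missesCore_le (hk : Monotone k) {ε : ENNReal}
    (hε : ∀ m (z : HierGroup N), labelLaw N {U | z ∉ core c k U m} ≤ ε) {n n' : ℕ}
    {z : HierGroup N} (hz : z ∉ originBall N k n) (hz' : z ∈ originBall N k n') :
    labelLaw N {U | MissesCore c k n U z} ≤ ε := by
  classical
  have hex : ∃ m, z ∈ originBall N k m := ⟨n', hz'⟩
  have hn : n < Nat.find hex := by
    by_contra! h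
    exact hz (originBall_mono hk h (Nat.find_spec hex))
  obtain ⟨m, hm⟩ : ∃ m, Nat.find hex = m + 1 := ⟨Nat.find hex - 1, by omega⟩
  have h1 : z ∈ originBall N k (m + 1) := hm ▸ Nat.find_spec hex
  have h2 : z ∉ originBall N k m := Nat.find_min hex (by omega)
  refine le_trans (measure_mono ?_) (hε m z)
  exact fun U hU => hU m ⟨by omega, h2, h1⟩

/-- Select one exit by exploring only labels that touch the origin ball of radius `k n`. Failure
forces that exit to miss the core, an event of probability at most `ε` that depends on the remaining
labels. -/
theorem prob_and_failedExit_le (hk : Monotone k) {ε : ENNReal}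
    (hε : ∀ m (z : HierGroup N), labelLaw N {U | z ∉ core c k U m} ≤ ε) (x : HierGroup N)
    (n n' : ℕ) {P : EdgeLabels N → Prop} (hP : LocalOn (ballPairs (k n) 0) P) :
    labelLaw N {U | P U ∧ FailedExit c k x n n' U} ≤ ε * labelLaw N {U | P U} := by
  classical
  -- An enumeration of the points selects the exit of least code; this makes the events `A z`
  -- mutually exclusive while keeping them local.
  obtain ⟨enc, henc⟩ := Countable.exists_injective_nat (HierGroup N)
  set T := touchingPairs (originBall N k n) with hT
  let A : HierGroup N → EdgeLabels N → Prop := fun z U => P U ∧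
    (z ∈ originBall N k n' ∧ IsExit c (originBall N k n) x U z) ∧
    ∀ z', z' ∈ originBall N k n' → IsExit c (originBall N k n) x U z' → enc z ≤ enc z'
  have hinT : insidePairs (originBall N k n) ⊆ T := insidePairs_subset_touchingPairs _
  have hexit : ∀ z, LocalOn T fun U => IsExit c (originBall N k n) x U z := by
    intro z
    refine (localOn_isExit _ x z).mono (Set.union_subset hinT ?_)
    rintro _ ⟨u, hu, rfl⟩
    exact mk_mem_touchingPairs.2 (Or.inl hu)
  have hA : ∀ z, LocalOn T (A z) := fun z => (hP.mono hinT).and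
    (((LocalOn.const _).and (hexit z)).and (LocalOn.forall fun z' =>
      (LocalOn.const _).imp ((hexit z').imp (LocalOn.const _))))
  have key := prob_exists_and_le (B := fun z U => MissesCore c k n U z) (ε := ε) hA
    (fun z => localOn_missesCore hk n z) (fun _ => disjoint_compl_right)
    (fun z z' U hz hz' => henc (le_antisymm (hz.2.2 z' hz'.2.1.1 hz'.2.1.2)
      (hz'.2.2 z hz.2.1.1 hz.2.1.2)))
    (fun z ⟨U, hU⟩ => prob_missesCore_le hk hε hU.2.1.2.1 hU.2.1.1)
  refine (measure_mono ?_).trans (key.trans (mul_le_mul_right (measure_mono ?_) _))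
  · rintro U ⟨hPU, ⟨z, hz, hze⟩, hfail⟩
    have hne : {m | ∃ z, (z ∈ originBall N k n' ∧ IsExit c (originBall N k n) x U z) ∧
        enc z = m}.Nonempty := ⟨enc z, z, ⟨hz, hze⟩, rfl⟩
    obtain ⟨z₀, hz₀, hz₀m⟩ := Nat.sInf_mem hne
    refine ⟨z₀, ⟨hPU, hz₀, fun z' hz' hze' => ?_⟩, hfail z₀ hz₀.1 hz₀.2⟩
    rw [hz₀m]
    exact Nat.sInf_le ⟨z', ⟨hz', hze'⟩, rfl⟩
  · rintro U ⟨z, hz⟩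
    exact hz.1

/-- Earlier failures are determined inside the current origin ball, so each further failure costs
another factor `1/2`. -/
theorem prob_forall_failedExit_eq_zero (hk : Monotone k)
    (hε : ∀ m (z : HierGroup N), labelLaw N {U | z ∉ core c k U m} ≤ 1 / 2) (x : HierGroup N)
    {s : ℕ → ℕ} (hs : Monotone s) (a : ℕ) :
    labelLaw N {U | ∀ i, a ≤ i → FailedExit c k x (s i) (s (i + 1)) U} = 0 := by
  have hloc : ∀ r, LocalOn (ballPairs (k (s (a + r))) (0 : HierGroup N))
      fun U => ∀ i < r, FailedExit c k x (s (a + i)) (s (a + i + 1)) U := by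
    intro r
    refine LocalOn.forall_mem (S := {i | i < r}) fun i hi => ?_
    have hir : a + i + 1 ≤ a + r := by
      have : i < r := hi
      omega
    exact (localOn_failedExit hk x (hs (Nat.le_succ _))).mono
      (ballPairs_mono (hk (hs hir)) (by simp [hierDist_self]))
  have hbound : ∀ r, labelLaw N {U | ∀ i < r, FailedExit c k x (s (a + i)) (s (a + i + 1)) U} ≤
      (1 / 2) ^ r := by
    intro r
    induction r with
    | zero => simp
    | succ r ih =>
      have h1 : {U : EdgeLabels N | ∀ i < r + 1, FailedExit c k x (s (a + i)) (s (a + i + 1)) U} =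
          {U | (∀ i < r, FailedExit c k x (s (a + i)) (s (a + i + 1)) U) ∧
            FailedExit c k x (s (a + r)) (s (a + r + 1)) U} := by
        ext U
        exact Nat.forall_lt_succ_right
      rw [h1, pow_succ']
      exact (prob_and_failedExit_le hk hε x _ _ (hloc r)).trans (mul_le_mul_right ih _)
  have hlim : Filter.Tendsto (fun r : ℕ => (1 / 2 : ENNReal) ^ r) Filter.atTop (nhds 0) :=
    ENNReal.tendsto_pow_atTop_nhds_zero_of_lt_one (by
      rw [one_div]
      exact ENNReal.inv_lt_one.2 (by norm_num))
  rw [← nonpos_iff_eq_zero]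
  refine ge_of_tendsto' hlim fun r => le_trans (measure_mono ?_) (hbound r)
  exact fun U hU i _ => hU (a + i) (by omega)

end Exploration

/-! ### Uniqueness of the infinite cluster -/

section Uniqueness

variable {N : ℕ} [NeZero N] {c : ℕ → ℝ} {k : ℕ → ℕ}

theorem uniqueInfiniteCluster_of_goodAt (hN : 2 ≤ N) (hk : StrictMono k)
    (hbase : ∀ j, 1 ≤ j → j ≤ k 0 → connProb N 1 c j = 1)
    (hcard : ∀ (U : EdgeLabels N) n y, (coreBall c k U n y).Nonempty →
      (1 / 2 : ℝ) * (N : ℝ) ^ k n ≤ (coreBall c k U n y).card)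
    {g : ℕ → ENNReal}
    (hg : ∀ n (y : HierGroup N), labelLaw N {U | ¬ GoodAt c k n (core c k U n) U y} ≤ g n)
    (hsum : ∑' n, g n ≤ 1 / 2)
    (hlong : ∀ (n : ℕ) (ε : ENNReal), 0 < ε → ∃ n', n < n' ∧
      labelLaw N {U | ∃ u ∈ hierBall (k n) (0 : HierGroup N), ∃ v, k n' < hierDist u v ∧
        (hierGraph N 1 c U).Adj u v} ≤ ε) :
    UniqueInfiniteCluster N 1 c := by
  have hkm := hk.monotone
  have hε : ∀ m (z : HierGroup N), labelLaw N {U | z ∉ core c k U m} ≤ 1 / 2 :=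
    fun m z => (prob_notMem_core_le hg z m).trans hsum
  choose f hf1 hf2 using hlong
  have hpos : ∀ i : ℕ, (0 : ENNReal) < (1 / 2) ^ i := fun i => by
    refine pos_iff_ne_zero.2 (pow_ne_zero _ ?_)
    simp
  -- The next scale is chosen so that an edge jumping from the ball at `s i` beyond distance `k (s
  -- (i + 1))` has probability at most `(1/2) ^ i`, which is summable for Borel–Cantelli.
  let s : ℕ → ℕ := fun i => Nat.rec 0 (fun i n => f n ((1 / 2) ^ i) (hpos i)) i
  have hs_succ : ∀ i, s (i + 1) = f (s i) ((1 / 2) ^ i) (hpos i) := fun i => rfl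
  have hsmono : StrictMono s := strictMono_nat_of_lt_succ fun i => by
    rw [hs_succ]
    exact hf1 _ _ _
  have hA : ∀ᵐ U ∂(labelLaw N), ∀ᶠ n in Filter.atTop, GoodAt c k n (core c k U n) U 0 := by
    have h := ae_eventually_notMem (μ := labelLaw N)
      (s := fun n => {U | ¬ GoodAt c k n (core c k U n) U 0}) (ne_top_of_le_ne_top (by simp)
        ((ENNReal.tsum_le_tsum fun n => hg n 0).trans hsum))
    filter_upwards [h] with U hU
    filter_upwards [hU] with n hn
    by_contra hcon
    exact hn hcon
  have hL : ∀ᵐ U ∂(labelLaw N), ∀ᶠ i in Filter.atTop,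
      ∀ u ∈ hierBall (k (s i)) (0 : HierGroup N), ∀ v, k (s (i + 1)) < hierDist u v →
        ¬ (hierGraph N 1 c U).Adj u v := by
    have h := ae_eventually_notMem (μ := labelLaw N)
      (s := fun i => {U | ∃ u ∈ hierBall (k (s i)) (0 : HierGroup N), ∃ v,
        k (s (i + 1)) < hierDist u v ∧ (hierGraph N 1 c U).Adj u v}) (by
          refine ne_top_of_le_ne_top ?_ (ENNReal.tsum_le_tsum fun i => hf2 (s i) _ (hpos i))
          rw [ENNReal.tsum_geometric, one_div, ENNReal.one_sub_inv_two]
          simp)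
    filter_upwards [h] with U hU
    filter_upwards [hU] with i hi u hu v huv hadj
    exact hi ⟨u, hu, v, huv, hadj⟩
  have hF : ∀ᵐ U ∂(labelLaw N), ∀ x : HierGroup N, ∀ a : ℕ,
      ¬ ∀ i, a ≤ i → FailedExit c k x (s i) (s (i + 1)) U := by
    rw [ae_all_iff]
    intro x
    rw [ae_all_iff]
    intro a
    rw [ae_iff]
    simpa only [not_not] using prob_forall_failedExit_eq_zero hkm hε x hsmono.monotone a
  filter_upwards [hA, hL, hF] with U hAU hLU hFU
  obtain ⟨n₁, hn₁⟩ := Filter.eventually_atTop.1 hAU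
  obtain ⟨i₁, hi₁⟩ := Filter.eventually_atTop.1 hLU
  -- Beyond `n₁` every origin ball is good, so a point in the core at the scale where it lies is
  -- never removed later.
  have hstay : ∀ z m, n₁ ≤ m → z ∈ originBall N k (m + 1) → z ∈ core c k U m →
      ∀ n, m ≤ n → z ∈ core c k U n := by
    intro z m hm hz hzc n hn
    exact mem_core_of_forall_goodAt hn hzc fun i hi _ => (hn₁ i (by omega)).congr
      (le_trans hz (hkm (by omega)))
  obtain ⟨y₀, hy₀, hy₀c⟩ := exists_mem_core_of_goodAt hN hk (hn₁ n₁ le_rfl)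
  have hy₀' : ∀ n, n₁ + 1 ≤ n → y₀ ∈ core c k U n :=
    hstay y₀ (n₁ + 1) (by omega) (le_trans hy₀ (hkm (by omega))) hy₀c
  have hmain : ∀ z m, n₁ ≤ m → z ∈ originBall N k (m + 1) → z ∈ core c k U m →
      (hierGraph N 1 c U).Reachable z y₀ := by
    intro z m hm hz hzc
    refine reachable_of_mem_core hbase (n := m + 1) (hstay z m hm hz hzc _ (by omega))
      (hy₀' _ (by omega)) ?_
    exact hierDist_trans_le (hierDist_comm 0 z ▸ hz) (le_trans hy₀ (hkm (by omega)))
  refine ⟨(hierGraph N 1 c U).connectedComponentMk y₀,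
    infinite_supp_of_mem_core hN hk hbase (hcard U) hy₀', ?_⟩
  intro K
  induction K using SimpleGraph.ConnectedComponent.ind with
  | h x =>
    intro hinf
    rw [SimpleGraph.ConnectedComponent.eq]
    by_contra hnot
    -- From this index on, the origin balls are good, no edge jumps too far, and `x` lies in the
    -- ball being explored, because `i ≤ s i ≤ k (s i)`.
    set a := n₁ + i₁ + hierDist 0 x with ha
    refine hFU x a fun i hi => ?_
    have hsi : i ≤ s i := hsmono.le_apply
    have hki : s i ≤ k (s i) := hk.le_apply
    have hxB : x ∈ originBall N k (s i) := by
      change hierDist 0 x ≤ k (s i)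
      omega
    refine ⟨?_, ?_⟩
    · obtain ⟨z, hz⟩ := exists_isExit (finite_originBall (s i)) hxB hinf
      refine ⟨z, ?_, hz⟩
      obtain ⟨-, u, hu, -, hadj⟩ := hz
      by_contra hzout
      refine hi₁ i (by omega) u (mem_hierBall.2 hu) z ?_ hadj
      exact lt_hierDist_of_crossing (k := k (s i)) (hkm (hsmono.monotone (Nat.le_succ i)))
        (mem_hierBall.2 hu) (fun h => hzout (mem_hierBall.1 h))
    -- An exit in the core at its own scale would connect `x` to `y₀`.
    · intro z _ hz m hm hzc
      exact hnot (hz.reachable.trans (hmain z m (by omega) hm.2.2 hzc))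

end Uniqueness

/-! ### Choice of scales and constants; part (a) -/

section Scales

variable {N : ℕ}

theorem exists_pow_between (hN : 2 ≤ N) {w : ℝ} (hw : 1 ≤ w) :
    ∃ l : ℕ, w ≤ (N : ℝ) ^ l ∧ (N : ℝ) ^ l ≤ N * w := by
  obtain ⟨n, hn1, hn2⟩ := exists_nat_pow_near hw (show (1 : ℝ) < N by exact_mod_cast hN)
  refine ⟨n + 1, hn2.le, ?_⟩
  rw [pow_succ']
  gcongr

theorem exists_threshold {γ δ κ : ℝ} (hγ : 1 < γ) (hδ : 0 < δ) (hκ : 0 < κ) :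
    ∃ n₀ : ℕ, 2 ≤ n₀ ∧ (∀ a : ℕ, n₀ ≤ a → (((a : ℝ) ^ γ) ^ 2)⁻¹ ≤ κ) ∧
      (∀ a : ℕ, n₀ ≤ a → ((a : ℝ) ^ γ) ^ 6 * Real.exp (-(a : ℝ) ^ δ) ≤ κ) ∧
      ∑' n : ℕ, (((n + n₀ : ℕ) : ℝ) ^ γ)⁻¹ ≤ 1 / 2 := by
  have hγ0 : 0 < γ := by linarith
  have hcast : Filter.Tendsto (fun a : ℕ => (a : ℝ)) Filter.atTop Filter.atTop :=
    tendsto_natCast_atTop_atTop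
  have h1 : ∀ᶠ a : ℕ in Filter.atTop, (((a : ℝ) ^ γ) ^ 2)⁻¹ ≤ κ := by
    have ht : Filter.Tendsto (fun a : ℕ => (((a : ℝ) ^ γ) ^ 2)⁻¹) Filter.atTop (nhds 0) :=
      (((Filter.tendsto_pow_atTop two_ne_zero).comp
        ((tendsto_rpow_atTop hγ0).comp hcast))).inv_tendsto_atTop
    exact ht.eventually_le_const hκ
  have h2 : ∀ᶠ a : ℕ in Filter.atTop, ((a : ℝ) ^ γ) ^ 6 * Real.exp (-(a : ℝ) ^ δ) ≤ κ := by
    -- In the variable `x = a^δ` the expression becomes `x^{6γ/δ} exp (-x)`.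
    have ht := (tendsto_rpow_mul_exp_neg_mul_atTop_nhds_zero (γ * 6 / δ) 1 one_pos).comp
      ((tendsto_rpow_atTop hδ).comp hcast)
    filter_upwards [ht.eventually_le_const hκ] with a ha
    refine le_trans (le_of_eq ?_) ha
    simp only [Function.comp_apply]
    have ha0 : (0 : ℝ) ≤ a := Nat.cast_nonneg a
    rw [← Real.rpow_mul ha0, mul_div_cancel₀ _ hδ.ne', Real.rpow_mul ha0, neg_one_mul]
    norm_cast
  have h3 : ∀ᶠ n₀ : ℕ in Filter.atTop, ∑' n : ℕ, (((n + n₀ : ℕ) : ℝ) ^ γ)⁻¹ ≤ 1 / 2 :=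
    (tendsto_sum_nat_add (fun n : ℕ => ((n : ℝ) ^ γ)⁻¹)).eventually_le_const (by norm_num)
  obtain ⟨n₁, hn₁⟩ := Filter.eventually_atTop.1 (h1.and (h2.and h3))
  refine ⟨max 2 n₁, le_max_left _ _, fun a ha => (hn₁ a ((le_max_right _ _).trans ha)).1,
    fun a ha => (hn₁ a ((le_max_right _ _).trans ha)).2.1, (hn₁ _ (le_max_right _ _)).2.2⟩

/-- The recursion for the failure probability starts from zero, since the core at scale `0` is
everything. At later scales an empty core implies failure of goodness one scale below. -/
theorem prob_not_goodAt_le_of_scales [NeZero N] {c : ℕ → ℝ} {k : ℕ → ℕ} (hN : 2 ≤ N)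
    (hk : StrictMono k) (hc0 : ∀ k, 1 ≤ k → 0 ≤ c k) {b e : ℕ → ℝ} (hb0 : ∀ n, 0 ≤ b n)
    (he0 : ∀ n, 0 ≤ e n)
    (hcard : ∀ (U : EdgeLabels N) n y, (coreBall c k U n y).Nonempty →
      (1 / 2 : ℝ) * (N : ℝ) ^ k n ≤ (coreBall c k U n y).card)
    (he : ∀ n j, k n < j → j ≤ k (n + 1) →
      Real.exp (-(((1 / 2 : ℝ) * (N : ℝ) ^ k n) ^ 2 * (c j / (N : ℝ) ^ (2 * j)))) ≤ e n)
    (hb : ∀ n, ((N : ℝ) ^ (k (n + 1) - k n)) ^ 2 * (b n ^ 2 + e n) ≤ b (n + 1))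
    (n : ℕ) (y : HierGroup N) :
    labelLaw N {U | ¬ GoodAt c k n (core c k U n) U y} ≤ ENNReal.ofReal (b (n + 1)) := by
  have step : ∀ n, (∀ y : HierGroup N,
      labelLaw N {U | ¬ ∃ v, hierDist y v ≤ k n ∧ v ∈ core c k U n} ≤ ENNReal.ofReal (b n)) →
      ∀ y : HierGroup N, labelLaw N {U | ¬ GoodAt c k n (core c k U n) U y} ≤
        ENNReal.ofReal (b (n + 1)) := fun n hn y =>
    (prob_not_goodAt_le hk.monotone hc0 (by positivity) (hb0 n) (he0 n) (fun U => hcard U n)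
      (he n) hn y).trans (ENNReal.ofReal_le_ofReal (hb n))
  refine step n ?_ y
  induction n with
  | zero =>
    intro y
    have : {U : EdgeLabels N | ¬ ∃ v, hierDist y v ≤ k 0 ∧ v ∈ core c k U 0} = ∅ := by
      ext U
      simp only [Set.mem_ofPred_eq, Set.mem_empty_iff_false, iff_false, not_not]
      exact ⟨y, by simp [hierDist_self], trivial⟩
    rw [this, measure_empty]
    exact zero_le
  | succ n ih =>
    intro y
    refine (measure_mono ?_).trans (step n ih y)
    exact fun U hU hgood => hU (exists_mem_core_of_goodAt hN hk hgood)

theorem exists_prob_long_edge_le [NeZero N] {c : ℕ → ℝ} {k : ℕ → ℕ} (hN : 2 ≤ N)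
    (hk : StrictMono k) (hc0 : ∀ k, 1 ≤ k → 0 ≤ c k) {A : ℝ} (hA : 0 ≤ A)
    {r : ℕ} (hc : ∀ k, 1 ≤ k → c k ≤ A * (k : ℝ) ^ r) (n : ℕ) (ε : ENNReal) (hε : 0 < ε) :
    ∃ n', n < n' ∧
      labelLaw N {U | ∃ u ∈ hierBall (k n) (0 : HierGroup N), ∃ v, k n' < hierDist u v ∧
        (hierGraph N 1 c U).Adj u v} ≤ ε := by
  set W : ℝ := ∑' j : ℕ, (j : ℝ) ^ r / (N : ℝ) ^ j with hW
  have hN0 : (0 : ℝ) < N := by positivity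
  have ht : Filter.Tendsto (fun l : ℕ => ENNReal.ofReal (A * W * ((l : ℝ) + 1) ^ r *
      ((N : ℝ) ^ k n / (N : ℝ) ^ l))) Filter.atTop (nhds 0) := by
    rw [← ENNReal.ofReal_zero]
    refine ENNReal.tendsto_ofReal ?_
    have h1 := ((summable_pow_div_pow hN r).tendsto_atTop_zero.comp
      (Filter.tendsto_add_atTop_nat 1)).const_mul (A * W * (N : ℝ) ^ k n * N)
    rw [mul_zero] at h1
    refine h1.congr fun l => ?_
    simp only [Function.comp_apply, pow_succ (N : ℝ) l]
    push_cast
    field_simp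
  obtain ⟨n', hn', hlt⟩ := (((ht.comp hk.tendsto_atTop).eventually_le_const hε).and
    (Filter.eventually_gt_atTop n)).exists
  exact ⟨n', hlt, (prob_long_edge_le hN hc0 hA hc 0 _ _).trans hn'⟩

theorem percolates_and_unique_of_large (hN : 2 ≤ N) {α : ℝ} (hα : 2 < α) :
    ∃ C₀' : ℝ, 0 < C₀' ∧ ∃ C₂' : ℝ, 0 < C₂' ∧ ∀ C₀ C₁ C₂ : ℝ, 0 ≤ C₁ → C₀' < C₀ → C₂' < C₂ →
      Percolates N 1 (criticalRate C₀ C₁ C₂ α) ∧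
      UniqueInfiniteCluster N 1 (criticalRate C₀ C₁ C₂ α) := by
  have : NeZero N := ⟨by omega⟩
  have hN0 : (0 : ℝ) < N := by positivity
  have hN1 : (1 : ℝ) < N := by exact_mod_cast hN
  -- The midpoint of `1` and `α / 2`: above `1` for `∑ 1 / w n` to converge, below `α / 2` for `δ =
  -- α - 2γ` to be positive.
  set γ : ℝ := (α + 2) / 4 with hγ
  have hγ1 : 1 < γ := by rw [hγ]; linarith
  have hγ0 : 0 < γ := by linarith
  set δ : ℝ := α - 2 * γ with hδ
  have hδ0 : 0 < δ := by rw [hδ, hγ]; linarith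
  -- Since `w (n + 1) ≤ 2^γ w n`, the target `(w (n + 1) ^ 4)⁻¹` is at least `(q * w n ^ 4)⁻¹`. The
  -- value of `κ` below lets two error terms share this target equally, with `N ^ 2` absorbing the
  -- rounding of `w n` to a power of `N`.
  set q : ℝ := ((2 : ℝ) ^ γ) ^ 4 with hq
  have hq0 : 0 < q := by positivity
  obtain ⟨n₀, hn₀, hκ1, hκ2, htail⟩ := exists_threshold (κ := 1 / (2 * q * (N : ℝ) ^ 2)) hγ1 hδ0
    (by positivity)
  set w : ℕ → ℝ := fun n => ((n + n₀ : ℕ) : ℝ) ^ γ with hw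
  have ha2 : ∀ n : ℕ, (2 : ℝ) ≤ ((n + n₀ : ℕ) : ℝ) := fun n => by
    exact_mod_cast hn₀.trans (Nat.le_add_left _ _)
  have hw1 : ∀ n, 1 < w n := fun n => Real.one_lt_rpow (by linarith [ha2 n]) hγ0
  have hw0 : ∀ n, 0 < w n := fun n => by linarith [hw1 n]
  have hwsucc : ∀ n, w (n + 1) ≤ 2 ^ γ * w n := by
    intro n
    rw [hw, ← Real.mul_rpow (by norm_num) (by positivity)]
    refine Real.rpow_le_rpow (by positivity) ?_ hγ0.le
    have := ha2 n
    push_cast at this ⊢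
    linarith
  have hwsum : Summable fun n => (w n)⁻¹ :=
    (summable_nat_add_iff n₀).2 (Real.summable_nat_rpow_inv.2 hγ1)
  choose l hl1 hl2 using fun n => exists_pow_between hN (hw1 n).le
  have hlpos : ∀ n, 0 < l n := by
    intro n
    rw [Nat.pos_iff_ne_zero]
    intro h0
    have := hl1 n
    rw [h0, pow_zero] at this
    linarith [hw1 n]
  set k : ℕ → ℕ := fun n => n₀ + ∑ i ∈ Finset.range n, l i with hk
  have hksucc : ∀ n, k (n + 1) = k n + l n := fun n => by
    simp only [hk, Finset.sum_range_succ, add_assoc]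
  have hkdiff : ∀ n, k (n + 1) - k n = l n := fun n => by rw [hksucc]; omega
  have hkmono : StrictMono k := strictMono_nat_of_lt_succ fun n => by
    rw [hksucc]
    have := hlpos n
    omega
  have hkge : ∀ n, n + n₀ ≤ k n := by
    intro n
    induction n with
    | zero => simp [hk]
    | succ n ih =>
      have := hlpos n
      rw [hksucc]
      omega
  -- The first constant makes all connections up to distance `k 0 = n₀` certain. In the second, `4`
  -- compensates two core densities `1/2` and `N ^ 2` the bound `N ^ l n ≤ N * w n`. Neither depends
  -- on `C₁`.
  refine ⟨(N : ℝ) ^ (2 * n₀), by positivity, 4 * (N : ℝ) ^ 2, by positivity,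
    fun C₀ C₁ C₂ h1 h0 h2 => ?_⟩
  have hC0 : 0 ≤ C₀ := le_trans (by positivity) h0.le
  have hC2 : 0 ≤ C₂ := le_trans (by positivity) h2.le
  set c := criticalRate C₀ C₁ C₂ α with hc
  have hc0 : ∀ k, 1 ≤ k → 0 ≤ c k := fun k _ => criticalRate_nonneg hC0 h1 hC2 k
  have hbase : ∀ j, 1 ≤ j → j ≤ k 0 → connProb N 1 c j = 1 := by
    intro j hj hjk
    refine min_eq_right ?_
    rw [one_le_div (by positivity)]
    have hcj : C₀ ≤ c j := by
      have hlog : 0 ≤ Real.log j := Real.log_natCast_nonneg j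
      have : 0 ≤ C₁ * Real.log j + C₂ * (j : ℝ) ^ α := by positivity
      simp only [hc, criticalRate]
      linarith
    refine le_trans ?_ (h0.le.trans hcj)
    rw [← Real.rpow_natCast]
    refine Real.rpow_le_rpow_of_exponent_le hN1.le ?_
    have hjn : (j : ℝ) ≤ n₀ := by
      have : j ≤ n₀ := by simpa [hk] using hjk
      exact_mod_cast this
    push_cast
    linarith
  -- densities of the core
  set D : ℕ → ℝ := fun n => 1 - ∑ i ∈ Finset.range n, (w i)⁻¹ with hD
  have hDhalf : ∀ n, 1 / 2 ≤ D n := by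
    intro n
    have := (hwsum.sum_le_tsum (Finset.range n) fun i _ => (inv_pos.2 (hw0 i)).le).trans htail
    simp only [hD]
    linarith
  have hDone : ∀ n, D n ≤ 1 := by
    intro n
    have : 0 ≤ ∑ i ∈ Finset.range n, (w i)⁻¹ :=
      Finset.sum_nonneg fun i _ => (inv_pos.2 (hw0 i)).le
    simp only [hD]
    linarith
  -- There are at least `w n` sub-balls, so losing one costs density at most `(w n)⁻¹`, as `D n ≤
  -- 1`.
  have hDstep : ∀ n, D (n + 1) * (N : ℝ) ^ (k (n + 1) - k n) ≤
      D n * ((N : ℝ) ^ (k (n + 1) - k n) - 1) := by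
    intro n
    rw [hkdiff]
    have h3 : D (n + 1) = D n - (w n)⁻¹ := by
      simp only [hD, Finset.sum_range_succ]
      ring
    have h4 : 1 ≤ (w n)⁻¹ * (N : ℝ) ^ l n := by
      rw [inv_mul_eq_div, one_le_div (hw0 n)]
      exact hl1 n
    rw [h3]
    nlinarith [hDone n]
  have hcard : ∀ (U : EdgeLabels N) n y, (coreBall c k U n y).Nonempty →
      (1 / 2 : ℝ) * (N : ℝ) ^ k n ≤ (coreBall c k U n y).card := by
    intro U n y hne
    refine le_trans ?_ (card_coreBall_ge hN hkmono (hDone 0)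
      (fun n => le_trans (by norm_num) (hDhalf n)) hDstep hne)
    exact mul_le_mul_of_nonneg_right (hDhalf n) (by positivity)
  -- failure probabilities
  set b : ℕ → ℝ := fun n => (w n ^ 4)⁻¹ with hb
  set e : ℕ → ℝ := fun n => Real.exp (-((n + n₀ : ℕ) : ℝ) ^ δ) with he
  have hexp : ∀ n j, k n < j → j ≤ k (n + 1) →
      Real.exp (-(((1 / 2 : ℝ) * (N : ℝ) ^ k n) ^ 2 * (c j / (N : ℝ) ^ (2 * j)))) ≤ e n := by
    intro n j hj hj'
    refine Real.exp_le_exp.2 (neg_le_neg ?_)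
    set a : ℝ := ((n + n₀ : ℕ) : ℝ) with ha
    have ha0 : 0 < a := by linarith [ha2 n]
    have haj : a ≤ j := Nat.cast_le.2 ((hkge n).trans hj.le)
    have hcj : 4 * (N : ℝ) ^ 2 * a ^ α ≤ c j := by
      have hlog : 0 ≤ Real.log j := Real.log_natCast_nonneg j
      have hpow : a ^ α ≤ (j : ℝ) ^ α := Real.rpow_le_rpow ha0.le haj (by linarith)
      have h3 : 4 * (N : ℝ) ^ 2 * a ^ α ≤ C₂ * (j : ℝ) ^ α :=
        mul_le_mul h2.le hpow (by positivity) hC2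
      have h4 : 0 ≤ C₁ * Real.log j := by positivity
      simp only [hc, criticalRate]
      linarith
    have hNj : (N : ℝ) ^ (2 * j) ≤ ((N : ℝ) ^ k n) ^ 2 * ((N : ℝ) * w n) ^ 2 := by
      calc (N : ℝ) ^ (2 * j) ≤ (N : ℝ) ^ (2 * k (n + 1)) :=
            pow_le_pow_right₀ hN1.le (by omega)
        _ = ((N : ℝ) ^ k n) ^ 2 * ((N : ℝ) ^ l n) ^ 2 := by rw [hksucc]; ring
        _ ≤ _ := by gcongr; exact hl2 n
    -- The rate contributes `a^α`, and the larger distance costs `w n ^ 2 = a^{2γ}`; the surplus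
    -- `a^δ` is the exponent in `e n`.
    have hsplit : a ^ δ * w n ^ 2 = a ^ α := by
      rw [hw, ← Real.rpow_natCast, ← Real.rpow_mul (by positivity), ← Real.rpow_add ha0]
      congr 1
      rw [hδ]
      push_cast
      ring
    calc a ^ δ = ((1 / 2 : ℝ) * (N : ℝ) ^ k n) ^ 2 * (4 * (N : ℝ) ^ 2 * a ^ α /
          (((N : ℝ) ^ k n) ^ 2 * ((N : ℝ) * w n) ^ 2)) := by
          rw [← hsplit]
          have := hw0 n
          field_simp
          norm_num
      _ ≤ _ := by
          refine mul_le_mul_of_nonneg_left ?_ (by positivity)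
          exact div_le_div₀ (hc0 j (by omega)) hcj (by positivity) hNj
  have hbstep : ∀ n, ((N : ℝ) ^ (k (n + 1) - k n)) ^ 2 * (b n ^ 2 + e n) ≤ b (n + 1) := by
    intro n
    rw [hkdiff]
    have hwn := hw0 n
    have h3 : (w n ^ 2)⁻¹ ≤ 1 / (2 * q * (N : ℝ) ^ 2) := hκ1 _ (Nat.le_add_left _ _)
    have h4 : w n ^ 6 * e n ≤ 1 / (2 * q * (N : ℝ) ^ 2) := hκ2 _ (Nat.le_add_left _ _)
    have h5 : (q * w n ^ 4)⁻¹ ≤ b (n + 1) := by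
      refine inv_anti₀ (by have := hw0 (n + 1); positivity) ?_
      rw [hq, ← mul_pow]
      exact pow_le_pow_left₀ (hw0 _).le (hwsucc n) 4
    refine le_trans ?_ h5
    have he0 : 0 < e n := Real.exp_pos _
    calc ((N : ℝ) ^ l n) ^ 2 * (b n ^ 2 + e n) ≤ ((N : ℝ) * w n) ^ 2 * (b n ^ 2 + e n) := by
          gcongr
          exact hl2 n
      _ = (N : ℝ) ^ 2 * (w n ^ 4)⁻¹ * ((w n ^ 2)⁻¹ + w n ^ 6 * e n) := by
          simp only [hb]
          field_simp
      _ ≤ (N : ℝ) ^ 2 * (w n ^ 4)⁻¹ *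
          (1 / (2 * q * (N : ℝ) ^ 2) + 1 / (2 * q * (N : ℝ) ^ 2)) := by gcongr
      _ = (q * w n ^ 4)⁻¹ := by
          field_simp
          norm_num
  have hb0 : ∀ n, 0 ≤ b n := fun n => by have := hw0 n; positivity
  have hgood := prob_not_goodAt_le_of_scales hN hkmono hc0 hb0
    (fun n => (Real.exp_pos _).le) hcard hexp hbstep
  have hsum : ∑' n, ENNReal.ofReal (b (n + 1)) ≤ 1 / 2 := by
    have h3 : ∀ n, b n ≤ (w n)⁻¹ := fun n =>
      inv_anti₀ (hw0 n) (le_self_pow₀ (hw1 n).le (by norm_num))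
    have h4 : ∑' n, ENNReal.ofReal (b (n + 1)) ≤ ∑' n, ENNReal.ofReal (w n)⁻¹ :=
      (ENNReal.tsum_comp_le_tsum_of_injective (f := fun n : ℕ => n + 1)
        (fun _ _ h => by simpa using h) (fun n => ENNReal.ofReal (b n))).trans
        (ENNReal.tsum_le_tsum fun n => ENNReal.ofReal_le_ofReal (h3 n))
    refine h4.trans ?_
    rw [← ENNReal.ofReal_tsum_of_nonneg (fun n => (inv_pos.2 (hw0 n)).le) hwsum]
    refine (ENNReal.ofReal_le_ofReal htail).trans (le_of_eq ?_)
    rw [ENNReal.ofReal_div_of_pos (by norm_num)]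
    simp
  obtain ⟨r, hr⟩ := exists_nat_ge (max 1 α)
  have hr1 : 1 ≤ r := by exact_mod_cast (le_max_left _ _).trans hr
  have hrate : ∀ k, 1 ≤ k → c k ≤ 3 * (C₀ + C₁ + C₂) * (k : ℝ) ^ r := fun k hk =>
    criticalRate_le (by positivity) (by linarith) (by linarith) (by linarith) hr1
      ((le_max_right _ _).trans hr) hk
  exact ⟨percolates_of_goodAt hN hkmono hbase hcard hgood hsum,
    uniqueInfiniteCluster_of_goodAt hN hkmono hbase hcard hgood hsum
      (exists_prob_long_edge_le hN hkmono hc0 (by positivity) hrate)⟩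

end Scales

theorem theorem3p3 (N : ℕ) (hN : 2 ≤ N) :
    -- (a)
    (∀ α : ℝ, 2 < α → ∀ C₁ : ℝ, 0 ≤ C₁ →
      ∃ C₀' : ℝ, 0 < C₀' ∧ ∃ C₂' : ℝ, 0 < C₂' ∧
        ∀ C₀ C₂ : ℝ, C₀' < C₀ → C₂' < C₂ →
          Percolates N 1 (criticalRate C₀ C₁ C₂ α) ∧
          UniqueInfiniteCluster N 1 (criticalRate C₀ C₁ C₂ α)) ∧
    -- (b)
    (∀ α : ℝ, 0 ≤ α → ∀ C₁ : ℝ, 0 ≤ C₁ → C₁ < (N : ℝ) → ∀ C₀ : ℝ, 0 ≤ C₀ →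
      ¬ Percolates N 1 (criticalRate C₀ C₁ 0 α)) ∧
    -- (c)
    (∀ α : ℝ, 2 < α →
      ∃ C' : ℝ, 0 < C' ∧
        ∀ C₀ C₁ C₂ : ℝ, 0 ≤ C₀ → 0 ≤ C₁ → 0 ≤ C₂ → max C₀ (max C₁ C₂) < C' →
          ¬ Percolates N 1 (criticalRate C₀ C₁ C₂ α)) := by
  have : NeZero N := ⟨by omega⟩
  refine ⟨fun α hα C₁ h1 => ?_, fun α _ C₁ h1 h1N C₀ h0 => not_percolates_of_log hN h0 h1 h1N,
    fun α _ => exists_not_percolates_of_small hN α⟩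
  obtain ⟨C₀', h0', C₂', h2', h⟩ := percolates_and_unique_of_large hN hα
  exact ⟨C₀', h0', C₂', h2', fun C₀ C₂ h0 h2 => h C₀ C₁ C₂ h1 h0 h2⟩
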